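/- Let $n\ge 3$ and let $M$ be a smooth $n$-manifold with one end: a chart at infinity identifies the complement of a compact set with $\{x\in\mathbb R^n:|x|>R_0\}$, $R_0>0$. An *asymptotically flat vacuum initial data set* on $M$ is a pair $(g,k)$ of a Riemannian metric of class $C^2$ and a symmetric $(0,2)$-tensor field of class $C^1$ such that the vacuum constraint equations $$R_g+(\mathrm{Tr}_g k)^2-\|k\|_g^2=0,\qquad \mathrm{Div}_g\big(k-(\mathrm{Tr}_gk)g\big)=0$$ hold on $M$ and, for some $q>\frac{n-2}{2}$ (which may depend on the data), in the coordinates at infinity $\partial^\beta(g_{ij}-\delta_{ij})=O(|x|^{-q-|\beta|})$ for $|\beta|\le 2$ and $\partial^\beta k_{ij}=O(|x|^{-q-1-|\beta|})$ for $|\beta|\le 1$ as $|x|\to\infty$. For an integer $m\ge 0$ and $q>0$ the weighted Sobolev space $\mathcal H_{m,-q}$ on $M$ is given by the local $H^m$ norms on compact sets of coordinates together with the norms $$\|f\|^2=\sum_{i=0}^m\sum_{|\beta|=i}\int_{|x|>s}|\partial^\beta f|^2\,|x|^{-n+2(i+q)}\,dx\qquad(s>R_0)$$ on the end (for tensor fields: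 of all components); $g\in\mathcal H_{2,-p}$ means that this holds for $g$ locally and for $g-\delta$ on the end. Let $p>\frac{n-2}{2}$, let $(g_\infty,k_\infty)$ be an asymptotically flat vacuum initial data set on $M$ with $g_\infty\in\mathcal H_{2,-p}$ and $k_\infty\in\mathcal H_{1,-p-1}$, and let $(g_l,k_l)_{l\in\mathbb N}$ be asymptotically flat vacuum initial data sets on $M$ (with the same coordinates at infinity) such that $g_l\to g_\infty$ in $\mathcal H_{2,-p}$ and $k_l\to k_\infty$ in $\mathcal H_{1,-p-1}$ as $l\to\infty$. Write $\omega_{n-1}$ for the area of the unit sphere in $\mathbb R^n$, $\nu=x/|x|$ and $\pi=k-(\mathrm{Tr}_gk)g$. Then for each of these data sets the limits $$\mathcal E=\frac{1}{2(n-1)\omega_{n-1}}\lim_{r\to\infty}\int_{|x|=r}\sum_{i,j=1}^n(g_{ij,i}-g_{ii,j})\nu^j\,d\mathscr H^{n-1},\qquad \mathcal P_i=\frac{1}{(n-1)\omega_{n-1}}\lim_{r\to\infty}\int_{|x|=r}\sum_{j=1}^n\pi_{ij}\nu^j\,d\mathscr H^{n-1}$$ (the ADM energy and linear momentum) exist and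 are finite, and $$\lim_{l\to\infty}\mathcal E^{(l)}=\mathcal E^{(\infty)},\qquad \lim_{l\to\infty}\mathcal P^{(l)}=\mathcal P^{(\infty)}.$$ -/

import Mathlib

open Set Filter Topology MeasureTheory Bundle Manifold
open scoped ContDiff ENNReal Asymptotics

noncomputable section

namespace ADM

/-! ### Coordinate calculus on `ℝⁿ` -/

/-- `ℝⁿ` with the Euclidean norm. -/
abbrev Euc (n : ℕ) : Type := EuclideanSpace ℝ (Fin n)

/-- The partial derivative `∂ᵢ f`. -/
def pd {n : ℕ} (i : Fin n) (f : Euc n → ℝ) : Euc n → ℝ :=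
  fun x => fderiv ℝ f x (EuclideanSpace.single i 1)

/-- The iterated partial derivative `∂_{v 0} ∂_{v 1} ⋯ ∂_{v (a-1)} f`. -/
def iterPd {n a : ℕ} (v : Fin a → Fin n) (f : Euc n → ℝ) : Euc n → ℝ :=
  (List.ofFn v).foldr pd f

/-- The field of components of a `(0,2)`-tensor in some coordinates. -/
abbrev Components (n : ℕ) : Type := Euc n → Matrix (Fin n) (Fin n) ℝ

/-- Christoffel symbols `Γᵏᵢⱼ = ½ gᵏˡ (∂ᵢ gⱼₗ + ∂ⱼ gᵢₗ - ∂ₗ gᵢⱼ)`. -/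
def christoffel {n : ℕ} (G : Components n) (k i j : Fin n) : Euc n → ℝ :=
  fun x => (1 / 2 : ℝ) * ∑ l, (G x)⁻¹ k l *
    (pd i (fun y => G y j l) x + pd j (fun y => G y i l) x - pd l (fun y => G y i j) x)

/-- Ricci curvature
`Ricᵢⱼ = ∂ₖ Γᵏᵢⱼ - ∂ⱼ Γᵏᵢₖ + Γᵏₖₗ Γˡᵢⱼ - Γᵏⱼₗ Γˡᵢₖ`. -/
def ricci {n : ℕ} (G : Components n) (i j : Fin n) : Euc n → ℝ :=
  fun x => ∑ k, (pd k (christoffel G k i j) x - pd j (christoffel G k i k) x) +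
    ∑ k, ∑ l, (christoffel G k k l x * christoffel G l i j x -
      christoffel G k j l x * christoffel G l i k x)

/-- Scalar curvature `R = gⁱʲ Ricᵢⱼ`. -/
def scalarCurvature {n : ℕ} (G : Components n) : Euc n → ℝ :=
  fun x => ∑ i, ∑ j, (G x)⁻¹ i j * ricci G i j x

/-- `Tr_g k = gⁱʲ kᵢⱼ`. -/
def traceWrt {n : ℕ} (G K : Components n) : Euc n → ℝ :=
  fun x => ∑ i, ∑ j, (G x)⁻¹ i j * K x i j

/-- `‖k‖²_g = gⁱᵃ gʲᵇ kᵢⱼ kₐᵦ`. -/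
def normSqWrt {n : ℕ} (G K : Components n) : Euc n → ℝ :=
  fun x => ∑ i, ∑ j, ∑ a, ∑ b, (G x)⁻¹ i a * (G x)⁻¹ j b * K x i j * K x a b

/-- The momentum tensor `πᵢⱼ = kᵢⱼ - (Tr_g k) gᵢⱼ`. -/
def momentumTensor {n : ℕ} (G K : Components n) : Components n :=
  fun x => K x - traceWrt G K x • G x

/-- The covariant derivative `∇ₖ Tᵢⱼ = ∂ₖ Tᵢⱼ - Γˡₖᵢ Tₗⱼ - Γˡₖⱼ Tᵢₗ`. -/
def covDeriv {n : ℕ} (G T : Components n) (k i j : Fin n) : Euc n → ℝ :=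
  fun x => pd k (fun y => T y i j) x - ∑ l, christoffel G l k i x * T x l j -
    ∑ l, christoffel G l k j x * T x i l

/-- The divergence `(Div_g T)ᵢ = gᵏʲ ∇ₖ Tᵢⱼ`. -/
def divergence {n : ℕ} (G T : Components n) (i : Fin n) : Euc n → ℝ :=
  fun x => ∑ k, ∑ j, (G x)⁻¹ k j * covDeriv G T k i j x

/-- The vacuum Einstein constraint equations at the point with coordinates `x`. -/
def VacuumConstraintsAt {n : ℕ} (G K : Components n) (x : Euc n) : Prop :=
  scalarCurvature G x + traceWrt G K x ^ 2 - normSqWrt G K x = 0 ∧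
    ∀ i, divergence G (momentumTensor G K) i x = 0

/-! ### Initial data on a manifold -/

section Manifold

variable (n : ℕ) (M : Type*) [TopologicalSpace M] [ChartedSpace (Euc n) M]

/-- A `(0,2)`-tensor field. -/
abbrev Tensor : Type _ :=
  ∀ x : M, TangentSpace (𝓡 n) x →L[ℝ] TangentSpace (𝓡 n) x →L[ℝ] ℝ

variable {n M} in
/-- The components `Tᵢⱼ` of a `(0,2)`-tensor field in the coordinates of the chart `φ`
(relevant on `φ.target` only). -/
def components (T : Tensor n M) (φ : OpenPartialHomeomorph M (Euc n)) : Components n :=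
  fun x => Matrix.of fun i j =>
    T (φ.symm x)
      (mfderiv (𝓡 n) (𝓡 n) φ.symm x (EuclideanSpace.single i (1 : ℝ) : Euc n))
      (mfderiv (𝓡 n) (𝓡 n) φ.symm x (EuclideanSpace.single j (1 : ℝ) : Euc n))

/-- A pair `(g, k)` of a Riemannian metric of class `C²` and a symmetric `(0,2)`-tensor field of
class `C¹`. -/
structure InitialData [IsManifold (𝓡 n) ∞ M] where
  /-- the metric -/
  g : ContMDiffRiemannianMetric (𝓡 n) 2 (Euc n) (fun x : M => TangentSpace (𝓡 n) x)
  /-- the second fundamental form -/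
  k : Tensor n M
  k_symm : ∀ (x : M) (v w : TangentSpace (𝓡 n) x), k x v w = k x w v
  k_contMDiff : ContMDiff (𝓡 n) ((𝓡 n).prod 𝓘(ℝ, Euc n →L[ℝ] Euc n →L[ℝ] ℝ)) 1
    (fun x : M => TotalSpace.mk' (Euc n →L[ℝ] Euc n →L[ℝ] ℝ)
      (E := fun x : M => TangentSpace (𝓡 n) x →L[ℝ] TangentSpace (𝓡 n) x →L[ℝ] ℝ) x (k x))

/-- Coordinates at infinity: `M` is the union of a compact set and of one end, which the chart
identifies with the exterior of a closed ball of `ℝⁿ`. -/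
structure EndChart where
  /-- the chart -/
  chart : OpenPartialHomeomorph M (Euc n)
  chart_mem : chart ∈ IsManifold.maximalAtlas (𝓡 n) ∞ M
  /-- the radius of the omitted ball -/
  radius : ℝ
  radius_pos : 0 < radius
  target_eq : chart.target = {x | radius < ‖x‖}
  isCompact_core : IsCompact chart.sourceᶜ
  isClosed_end : ∀ s, radius < s → IsClosed (chart.symm '' {x | s ≤ ‖x‖})

end Manifold

variable {n : ℕ} {M : Type*} [TopologicalSpace M] [ChartedSpace (Euc n) M]

/-- `f = O^m(|x|^{-q})`: for `|β| ≤ m` the derivatives `∂^β f` are `O(|x|^{-q-|β|})` as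
`|x| → ∞`. -/
def DecaysToOrder (m : ℕ) (q : ℝ) (f : Euc n → ℝ) : Prop :=
  ∀ a ≤ m, ∀ v : Fin a → Fin n,
    iterPd v f =O[Bornology.cobounded (Euc n)] fun x => ‖x‖ ^ (-q - a)

/-- `(M, g, k)` is an asymptotically flat initial data set for the vacuum Einstein equations:
the constraint equations hold (in all coordinates), and in the coordinates at infinity
`gᵢⱼ = δᵢⱼ + O²(|x|^{-q})`, `kᵢⱼ = O¹(|x|^{-q-1})` for some `q > (n-2)/2`. -/
structure IsAsymptoticallyFlatVacuum [IsManifold (𝓡 n) ∞ M] (e : EndChart n M)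
    (D : InitialData n M) : Prop where
  constraints : ∀ φ ∈ IsManifold.maximalAtlas (𝓡 n) ∞ M, ∀ x ∈ φ.target,
    VacuumConstraintsAt (components D.g.inner φ) (components D.k φ) x
  decay : ∃ q : ℝ, ((n : ℝ) - 2) / 2 < q ∧ ∀ i j,
    DecaysToOrder 2 q
      (fun x => components D.g.inner e.chart x i j - (1 : Matrix (Fin n) (Fin n) ℝ) i j) ∧
    DecaysToOrder 1 (q + 1) (fun x => components D.k e.chart x i j)

/-! ### Weighted Sobolev spaces -/

/-- `∑_{a ≤ m} ∑_{|β| = a} ∫_Ω |∂^β f|² w_a dx`, the sum being over ordered multi-indices. -/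
def sobolevSq (m : ℕ) (w : ℕ → Euc n → ℝ) (Ω : Set (Euc n)) (f : Euc n → ℝ) : ℝ≥0∞ :=
  ∑ a ∈ Finset.range (m + 1), ∑ v : Fin a → Fin n,
    ∫⁻ x in Ω, ENNReal.ofReal (iterPd v f x ^ 2 * w a x)

/-- The radial weight `|x|^{-n+2(a+q)}` of derivatives of order `a` in `H_{m,-q}`. -/
def radialWeight (q : ℝ) (a : ℕ) (x : Euc n) : ℝ := ‖x‖ ^ (-(n : ℝ) + 2 * (a + q))

/-- `T ∈ H_{m,-q}`, for `T` a `(0,2)`-tensor field of class `C^m` on `M` that is understood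
relative to the constant tensor `A` at infinity (`A = δ` for metrics, `A = 0` for second
fundamental forms): square integrable derivatives on compact sets of coordinates, and finite
weighted norm of `T - A` on the end. -/
def MemWeightedSobolev (e : EndChart n M) (m : ℕ) (q : ℝ) (A : Matrix (Fin n) (Fin n) ℝ)
    (T : Tensor n M) : Prop :=
  (∀ φ ∈ IsManifold.maximalAtlas (𝓡 n) ∞ M, ∀ K ⊆ φ.target, IsCompact K → ∀ i j,
    sobolevSq m (fun _ _ => 1) K (fun x => components T φ x i j) < ⊤) ∧
  ∀ s, e.radius < s → ∀ i j,
    sobolevSq m (radialWeight q) {x | s < ‖x‖}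
      (fun x => components T e.chart x i j - A i j) < ⊤

/-- `T_l → T` in `H_{m,-q}`: the norms of the difference tend to `0` on compact sets of
coordinates and, with the radial weights, on the end. -/
def TendstoWeightedSobolev (e : EndChart n M) (m : ℕ) (q : ℝ) (T : ℕ → Tensor n M)
    (T' : Tensor n M) : Prop :=
  (∀ φ ∈ IsManifold.maximalAtlas (𝓡 n) ∞ M, ∀ K ⊆ φ.target, IsCompact K → ∀ i j,
    Tendsto (fun l => sobolevSq m (fun _ _ => 1) K
      (fun x => components (T l) φ x i j - components T' φ x i j)) atTop (𝓝 0)) ∧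
  ∀ s, e.radius < s → ∀ i j,
    Tendsto (fun l => sobolevSq m (radialWeight q) {x | s < ‖x‖}
      (fun x => components (T l) e.chart x i j - components T' e.chart x i j)) atTop (𝓝 0)

/-! ### ADM energy and linear momentum -/

/-- The integral `∫_{|x| = r} f dℋⁿ⁻¹` over a round sphere, pulled back to the unit sphere. -/
def sphereIntegral (r : ℝ) (f : Euc n → ℝ) : ℝ :=
  r ^ (n - 1) * ∫ y : Metric.sphere (0 : Euc n) 1,
    f (r • (y : Euc n)) ∂(volume : Measure (Euc n)).toSphere

variable (n) in
/-- The area `ω_{n-1}` of the unit sphere of `ℝⁿ`. -/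
def sphereArea : ℝ := (volume : Measure (Euc n)).toSphere.real univ

/-- `1/(2(n-1)ω_{n-1}) ∫_{|x|=r} ∑ᵢⱼ (gᵢⱼ,ᵢ - gᵢᵢ,ⱼ) νʲ dℋⁿ⁻¹`, with `ν = x/|x|`. -/
def energyFlux (G : Components n) (r : ℝ) : ℝ :=
  1 / (2 * ((n : ℝ) - 1) * sphereArea n) * sphereIntegral r fun x =>
    ∑ i, ∑ j, (pd i (fun y => G y i j) x - pd j (fun y => G y i i) x) * (x j / ‖x‖)

/-- `1/((n-1)ω_{n-1}) ∫_{|x|=r} ∑ⱼ πᵢⱼ νʲ dℋⁿ⁻¹`, with `ν = x/|x|`. -/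
def momentumFlux (G K : Components n) (r : ℝ) (i : Fin n) : ℝ :=
  1 / (((n : ℝ) - 1) * sphereArea n) * sphereIntegral r fun x =>
    ∑ j, momentumTensor G K x i j * (x j / ‖x‖)

variable [IsManifold (𝓡 n) ∞ M]

/-- `E` is the ADM energy of the data: the limit of the flux integrals over large spheres. -/
def HasADMEnergy (e : EndChart n M) (D : InitialData n M) (E : ℝ) : Prop :=
  Tendsto (energyFlux (components D.g.inner e.chart)) atTop (𝓝 E)

/-- `P` is the ADM linear momentum of the data. -/
def HasADMMomentum (e : EndChart n M) (D : InitialData n M) (P : Fin n → ℝ) : Prop :=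
  ∀ i, Tendsto (fun r => momentumFlux (components D.g.inner e.chart) (components D.k e.chart) r i)
    atTop (𝓝 (P i))

end ADM

end

/-! Both charges are limits of fluxes of vector fields that are linear in the data: V_j = ∑_i (∂_i
g_ij - ∂_j g_ii) for the energy (`energyField`) and the linearisation of π at the flat metric for
the momentum (`momentumField`). The flux through a sphere changes with the radius by the integral of
the flat divergence. Now div V is the linear part of the scalar curvature at δ, so R_g - div V is
bounded by |g-δ||∂²g| + |∂g|², and the Hamiltonian constraint makes R_g quadratic in k. Hence div V
is quadratic in the data. The momentum constraint does the same for the other field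
(`flatDiv_energyField_isBigO`, `flatDiv_momentumField_isBigO`).

This is used twice. Under pointwise decay of rate q the divergences are O(|x|^{-2q-2}) with 2q+2 >
n, hence integrable, and the limits exist for each data set. Under the weighted norms,
|x|^{2p-(n-2)} times the quadratic terms is at most the density of the squared norms
(`products_le_density`), so the divergences beyond radius s have L¹ norm at most a constant times
s^{-(2p-(n-2))}, uniformly along the sequence (`exists_forall_lintegral_le`). The tails being
uniformly small, it suffices to compare fluxes on one fixed shell, averaged over the radius, and
there local L² convergence of the linear fields is enough (`tendsto_flux_limit`).

Two points need care. For n ≥ 4 an H² bound does not bound the supremum of g-δ, so g_l may be far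
from δ at some points of the end; but there |g-δ| is bounded below, and the obvious linear bound of
div V by |∂²g| is already a bound by |g-δ||∂²g|. Moreover, π is not linear in the data; its flux has
the same limit as that of its linearisation, since the difference is O(|x|^{-2q-1}) and 2q+1 > n-1
(`tendsto_momentumTensor_flux`). -/

noncomputable section

namespace ADM

/-! ### Regularity of tensor components in a chart -/

section Regularity

variable {n : ℕ} {M : Type*} [TopologicalSpace M] [ChartedSpace (Euc n) M]
  [IsManifold (𝓡 n) ∞ M]

/-- The coordinate vector field `∂ᵢ` of a chart, as a map into the tangent bundle. -/
theorem contMDiffOn_coordinateField {φ : OpenPartialHomeomorph M (Euc n)}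
    (hφ : φ ∈ IsManifold.maximalAtlas (𝓡 n) ∞ M) (m : ℕ) (i : Fin n) :
    ContMDiffOn (𝓡 n) ((𝓡 n).prod 𝓘(ℝ, Euc n)) m
      (fun x : Euc n => TotalSpace.mk' (Euc n) (E := fun x : M => TangentSpace (𝓡 n) x) (φ.symm x)
        (mfderiv (𝓡 n) (𝓡 n) φ.symm x (EuclideanSpace.single i (1 : ℝ) : Euc n))) φ.target := by
  have h1 : ContMDiffOn (𝓡 n) (𝓡 n) ∞ φ.symm φ.target := contMDiffOn_symm_of_mem_maximalAtlas hφ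
  -- The coordinate field is the tangent map of `φ.symm` applied to a constant section over the open
  -- target, where the derivative within the target is the derivative.
  have h2 := h1.contMDiffOn_tangentMapWithin (m := m) (by exact_mod_cast le_top)
    φ.open_target.uniqueMDiffOn
  have h3 : ContMDiff (𝓡 n) ((𝓡 n).prod 𝓘(ℝ, Euc n)) m
      (fun x : Euc n => (TotalSpace.mk' (Euc n) x (EuclideanSpace.single i (1 : ℝ) : Euc n) :
        TangentBundle (𝓡 n) (Euc n))) := by
    exact contMDiff_vectorSpace_iff_contDiff.2 contDiff_const
  refine (h2.comp (h3.contMDiffOn (s := φ.target)) (fun x hx => hx)).congr ?_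
  intro x hx
  simp only [Function.comp, tangentMapWithin]
  rw [mfderivWithin_of_isOpen φ.open_target hx]

/-- The components are the tensor, pulled back along `φ.symm`, paired with two coordinate fields;
all three are of class C^m as sections, and the result lives in a trivial line bundle. -/
theorem contDiffOn_components {T : Tensor n M} {m : ℕ}
    (hT : ContMDiff (𝓡 n) ((𝓡 n).prod 𝓘(ℝ, Euc n →L[ℝ] Euc n →L[ℝ] ℝ)) m
      (fun x : M => TotalSpace.mk' (Euc n →L[ℝ] Euc n →L[ℝ] ℝ)
        (E := fun x : M => TangentSpace (𝓡 n) x →L[ℝ] TangentSpace (𝓡 n) x →L[ℝ] ℝ) x (T x)))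
    {φ : OpenPartialHomeomorph M (Euc n)} (hφ : φ ∈ IsManifold.maximalAtlas (𝓡 n) ∞ M)
    (i j : Fin n) : ContDiffOn ℝ m (fun x => components T φ x i j) φ.target := by
  rw [← contMDiffOn_iff_contDiffOn]
  have h1 : ContMDiffOn (𝓡 n) (𝓡 n) m φ.symm φ.target :=
    (contMDiffOn_symm_of_mem_maximalAtlas hφ).of_le (by exact_mod_cast le_top)
  have hψ := hT.comp_contMDiffOn h1
  have := ContMDiffOn.clm_bundle_apply₂ (F₁ := Euc n) (F₂ := Euc n) (F₃ := ℝ)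
    (E₃ := fun _ : M => ℝ) (b := φ.symm) hψ
    (contMDiffOn_coordinateField hφ m i) (contMDiffOn_coordinateField hφ m j)
  intro x hx
  have := this x hx
  rw [contMDiffWithinAt_totalSpace] at this
  exact this.2

end Regularity

/-! ### Weak derivatives on a ray (du Bois-Reymond) -/

section DuBoisReymond

theorem integrable_mul_of_tsupport_subset {E : Type*} [NormedAddCommGroup E] [MeasurableSpace E]
    [BorelSpace E] [SecondCountableTopology E] {μ : Measure E} [IsFiniteMeasureOnCompacts μ]
    {U : Set E} {f g : E → ℝ}
    (hf : Continuous f) (hc : HasCompactSupport f) (hU : tsupport f ⊆ U)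
    (hg : ContinuousOn g U) : Integrable (fun x => f x * g x) μ := by
  rw [← integrableOn_iff_integrable_of_support_subset (s := tsupport f)]
  · exact (hf.continuousOn.mul (hg.mono hU)).integrableOn_compact hc
  · exact (Function.support_mul_subset_left f g).trans (subset_tsupport f)

/-- A smooth compactly supported function with vanishing integral has a compactly supported
primitive. -/
theorem exists_primitive_of_integral_eq_zero {R : ℝ} {θ : ℝ → ℝ} (hθ : ContDiff ℝ ∞ θ)
    (hc : HasCompactSupport θ) (hs : tsupport θ ⊆ Ioi R) (h0 : ∫ x, θ x = 0) :
    ∃ χ : ℝ → ℝ, ContDiff ℝ ∞ χ ∧ HasCompactSupport χ ∧ tsupport χ ⊆ Ioi R ∧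
      ∀ x, HasDerivAt χ (θ x) x := by
  obtain ⟨a, b, haR, hab⟩ : ∃ a b : ℝ, R < a ∧ tsupport θ ⊆ Icc a b := by
    rcases (tsupport θ).eq_empty_or_nonempty with he | hne
    -- For the zero function the interval is chosen empty, with left end still beyond `R`.
    · exact ⟨R + 1, R, by linarith, by simp [he]⟩
    · obtain ⟨a, ha, ha'⟩ := hc.isCompact.exists_isLeast hne
      obtain ⟨b, hb, hb'⟩ := hc.isCompact.exists_isGreatest hne
      exact ⟨a, b, hs ha, fun x hx => ⟨ha' hx, hb' hx⟩⟩
  have hz : ∀ x, x ∉ Icc a b → θ x = 0 := fun x hx => image_eq_zero_of_notMem_tsupport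
    fun h => hx (hab h)
  have hd : ∀ x, HasDerivAt (fun x => ∫ t in a..x, θ t) (θ x) x := fun x =>
    intervalIntegral.integral_hasDerivAt_right (hθ.continuous.intervalIntegrable _ _)
      hθ.continuous.stronglyMeasurable.stronglyMeasurableAtFilter hθ.continuous.continuousAt
  have hsup : Function.support (fun x => ∫ t in a..x, θ t) ⊆ Icc a b := by
    intro x hx
    by_contra hxI
    apply hx
    simp only
    by_cases hxa : x < a
    · rw [intervalIntegral.integral_symm, neg_eq_zero]
      apply intervalIntegral.integral_zero_ae
      -- The right end `a` of the integration interval lies in `Icc a b`, where `θ` is not known to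
      -- vanish, so it is discarded as a null set.
      have : ∀ᵐ t : ℝ, t ≠ a := by simp [ae_iff]
      filter_upwards [this] with t hta ht
      rw [uIoc_of_le hxa.le] at ht
      exact hz t fun h => hta (le_antisymm ht.2 h.1)
    · have hbx : b < x := by
        by_contra h
        exact hxI ⟨not_lt.1 hxa, not_lt.1 h⟩
      rw [intervalIntegral.integral_of_le (not_lt.1 hxa)]
      rw [← integral_Icc_eq_integral_Ioc, setIntegral_eq_integral_of_forall_compl_eq_zero, h0]
      intro t ht
      exact hz t fun h => ht ⟨h.1, h.2.trans hbx.le⟩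
  have hts : tsupport (fun x => ∫ t in a..x, θ t) ⊆ Icc a b :=
    closure_minimal hsup isClosed_Icc
  refine ⟨fun x => ∫ t in a..x, θ t, ?_, ?_, ?_, hd⟩
  · rw [contDiff_infty_iff_deriv]
    refine ⟨fun x => (hd x).differentiableAt, ?_⟩
    rwa [show deriv (fun x => ∫ t in a..x, θ t) = θ from funext fun x => (hd x).deriv]
  · exact HasCompactSupport.of_support_subset_isCompact isCompact_Icc hsup
  · exact hts.trans fun x hx => haR.trans_le hx.1

/-- The fundamental theorem of calculus for weak derivatives of continuous functions on a ray. -/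
theorem sub_eq_integral_of_weak_deriv {R : ℝ} {Φ A : ℝ → ℝ} (hΦ : ContinuousOn Φ (Ioi R))
    (hA : ContinuousOn A (Ioi R))
    (h : ∀ χ : ℝ → ℝ, ContDiff ℝ ∞ χ → HasCompactSupport χ → tsupport χ ⊆ Ioi R →
      ∫ r, χ r * A r = - ∫ r, deriv χ r * Φ r)
    {a b : ℝ} (ha : R < a) (hb : R < b) : Φ b - Φ a = ∫ r in a..b, A r := by
  -- With `B` a classical primitive of `A`, the function Φ - B has zero weak derivative, so it
  -- remains to show that it is constant.
  set B : ℝ → ℝ := fun r => ∫ t in a..r, A t with hB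
  have hdB : ∀ r ∈ Ioi R, HasDerivAt B (A r) r := by
    intro r hr
    have hsub : uIcc a r ⊆ Ioi R := by
      intro t ht
      exact (lt_min ha hr).trans_le ht.1
    exact intervalIntegral.integral_hasDerivAt_right (hA.mono hsub).intervalIntegrable
      (hA.stronglyMeasurableAtFilter isOpen_Ioi r hr) (hA.continuousAt (Ioi_mem_nhds hr))
  have hBc : ContinuousOn B (Ioi R) := fun r hr => (hdB r hr).continuousAt.continuousWithinAt
  have hF : ∀ χ : ℝ → ℝ, ContDiff ℝ ∞ χ → HasCompactSupport χ → tsupport χ ⊆ Ioi R →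
      ∫ r, deriv χ r * (Φ r - B r) = 0 := by
    intro χ h1 h2 h3
    have hd1 : Continuous (deriv χ) := h1.continuous_deriv (by simp)
    have hd2 : HasCompactSupport (deriv χ) := h2.deriv
    have hd3 : tsupport (deriv χ) ⊆ Ioi R := (tsupport_deriv_subset).trans h3
    have i1 := integrable_mul_of_tsupport_subset (μ := volume) hd1 hd2 hd3 hΦ
    have i2 := integrable_mul_of_tsupport_subset (μ := volume) hd1 hd2 hd3 hBc
    have key : ∫ r, χ r * fderiv ℝ B r 1 = - ∫ r, fderiv ℝ χ r 1 * B r := by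
      apply integral_mul_fderiv_eq_neg_fderiv_mul_of_integrable
      · simpa using i2
      · refine (integrable_mul_of_tsupport_subset (μ := volume) h1.continuous h2 h3 hA).congr
          (.of_forall fun r => ?_)
        by_cases hr : r ∈ tsupport χ
        · simp [(hdB r (h3 hr)).deriv]
        · simp [image_eq_zero_of_notMem_tsupport hr]
      · exact integrable_mul_of_tsupport_subset (μ := volume) h1.continuous h2 h3 hBc
      · exact fun x _ => h1.differentiable (by simp) x
      · exact fun x hx => (hdB x (h3 hx)).differentiableAt
    have e1 : ∫ r, χ r * fderiv ℝ B r 1 = ∫ r, χ r * A r := by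
      congr 1
      ext r
      by_cases hr : r ∈ tsupport χ
      · simp [(hdB r (h3 hr)).deriv]
      · simp [image_eq_zero_of_notMem_tsupport hr]
    have e2 : ∫ r, fderiv ℝ χ r 1 * B r = ∫ r, deriv χ r * B r := by simp
    rw [e1, e2, h χ h1 h2 h3] at key
    simp only [mul_sub]
    rw [integral_sub i1 i2]
    linarith
  -- The radius is such that the closed ball of radius `ρ` about `a` stays inside the ray. The
  -- constant value of Φ - B will be its mean `c` against this bump.
  obtain ⟨ρ, hρ, hρR⟩ : ∃ ρ : ℝ, 0 < ρ ∧ R < a - ρ := ⟨(a - R) / 2, by linarith, by linarith⟩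
  let ψ₀ : ContDiffBump a := ⟨ρ / 2, ρ, by linarith, by linarith⟩
  have s₀ : tsupport (ψ₀.normed volume) ⊆ Ioi R := by
    rw [ψ₀.tsupport_normed_eq]
    intro x hx
    rw [Metric.mem_closedBall, Real.dist_eq, abs_le] at hx
    have : -ρ ≤ x - a := hx.1
    simp only [mem_Ioi]
    linarith
  set c : ℝ := ∫ r, ψ₀.normed volume r * (Φ r - B r) with hcdef
  have hψ : ∀ ψ : ℝ → ℝ, ContDiff ℝ ∞ ψ → HasCompactSupport ψ → tsupport ψ ⊆ Ioi R →
      ∫ r, ψ r • (Φ r - B r - c) = 0 := by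
    intro ψ h1 h2 h3
    set m : ℝ := ∫ r, ψ r
    have iψ : Integrable ψ := h1.continuous.integrable_of_hasCompactSupport h2
    have iψ₀ : Integrable (ψ₀.normed volume) :=
      ψ₀.continuous_normed.integrable_of_hasCompactSupport ψ₀.hasCompactSupport_normed
    -- Subtracting from `ψ` its mass times the normed bump leaves integral zero, hence the
    -- derivative of a test function, which Φ - B annihilates.
    obtain ⟨χ, c1, c2, c3, c4⟩ := exists_primitive_of_integral_eq_zero (R := R)
      (θ := fun r => ψ r - m * ψ₀.normed volume r)
      (h1.sub (contDiff_const.mul ψ₀.contDiff_normed))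
      (h2.sub (ψ₀.hasCompactSupport_normed.mul_left))
      ((tsupport_sub _ _).trans (union_subset h3 ((tsupport_mul_subset_right).trans s₀)))
      (by rw [integral_sub iψ (iψ₀.const_mul m), integral_const_mul, ψ₀.integral_normed]; simp [m])
    have := hF χ c1 c2 c3
    rw [show deriv χ = fun r => ψ r - m * ψ₀.normed volume r from funext fun r => (c4 r).deriv]
      at this
    have j1 := integrable_mul_of_tsupport_subset (μ := volume) h1.continuous h2 h3 (hΦ.sub hBc)
    have j2 := integrable_mul_of_tsupport_subset (μ := volume) ψ₀.continuous_normed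
      ψ₀.hasCompactSupport_normed s₀ (hΦ.sub hBc)
    simp only [Pi.sub_apply] at j1 j2
    simp only [smul_eq_mul, mul_sub (ψ _) _ c]
    simp only [sub_mul, mul_assoc] at this
    rw [integral_sub j1 (j2.const_mul m), integral_const_mul] at this
    rw [integral_sub j1 (iψ.mul_const c), integral_mul_const]
    exact this
  have hae : ∀ᵐ x, x ∈ Ioi R → Φ x - B x - c = 0 :=
    isOpen_Ioi.ae_eq_zero_of_integral_contDiff_smul_eq_zero
      (((hΦ.sub hBc).sub continuousOn_const).locallyIntegrableOn measurableSet_Ioi)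
      fun ψ h1 h2 h3 => hψ ψ h1 h2 h3
  -- Almost everywhere equality becomes equality at every point by continuity, so it may be
  -- evaluated at `a` and `b`.
  have heq : EqOn (fun x => Φ x - B x - c) (fun _ => 0) (Ioi R) := by
    refine Measure.eqOn_open_of_ae_eq (μ := volume) ?_ isOpen_Ioi
      ((hΦ.sub hBc).sub continuousOn_const) continuousOn_const
    exact (ae_restrict_iff' measurableSet_Ioi).2 hae
  have e1 := heq ha
  have e2 := heq hb
  simp only [hB, intervalIntegral.integral_same] at e1 e2
  linarith

end DuBoisReymond

/-! ### Polar coordinates and the divergence theorem on spherical shells -/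

section Polar

variable {n : ℕ}

/-- Integration in polar coordinates. -/
theorem integral_eq_integral_sphereIntegral (hn : 0 < n) {f : Euc n → ℝ} (hf : Integrable f) :
    ∫ x, f x = ∫ r in Ioi (0 : ℝ), sphereIntegral r f := by
  have : Nonempty (Fin n) := ⟨⟨0, hn⟩⟩
  have hemb := (homeomorphUnitSphereProd (Euc n)).measurableEmbedding
  have hmp := (volume : Measure (Euc n)).measurePreserving_homeomorphUnitSphereProd
  let F : Metric.sphere (0 : Euc n) 1 × Ioi (0 : ℝ) → ℝ := fun z => f (z.2.1 • z.1.1)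
  have hFf : ∀ x : ({0}ᶜ : Set (Euc n)), F (homeomorphUnitSphereProd (Euc n) x) = f x.1 := by
    intro x
    have hx : ‖x.1‖ ≠ 0 := norm_ne_zero_iff.2 x.2
    simp [F, smul_smul, hx]
  have hdim : Module.finrank ℝ (Euc n) = n := by simp
  have hFi : Integrable F ((volume : Measure (Euc n)).toSphere.prod
      (Measure.volumeIoiPow (Module.finrank ℝ (Euc n) - 1))) := by
    rw [← hmp.integrable_comp_emb hemb]
    have h1 : IntegrableOn f {0}ᶜ := hf.integrableOn
    rw [integrableOn_iff_comap_subtypeVal (by measurability)] at h1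
    exact h1.congr (.of_forall fun x => (hFf x).symm)
  calc ∫ x, f x = ∫ x : ({0}ᶜ : Set (Euc n)), f x.1 ∂(volume.comap Subtype.val) := by
        rw [integral_subtype_comap (measurableSet_singleton _).compl f, restrict_compl_singleton]
    _ = ∫ z, F z ∂((volume : Measure (Euc n)).toSphere.prod
        (Measure.volumeIoiPow (Module.finrank ℝ (Euc n) - 1))) := by
        rw [← hmp.integral_comp hemb]
        exact integral_congr_ae (.of_forall fun x => (hFf x).symm)
    _ = ∫ r : Ioi (0 : ℝ), (∫ y, F (y, r) ∂(volume : Measure (Euc n)).toSphere)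
        ∂(Measure.volumeIoiPow (n - 1)) := by
        rw [integral_prod_symm _ hFi, hdim]
    _ = ∫ r in Ioi (0 : ℝ), sphereIntegral r f := by
        simp only [Measure.volumeIoiPow, ENNReal.ofReal]
        rw [integral_withDensity_eq_integral_smul
          (measurable_subtype_coe.pow_const _).real_toNNReal]
        rw [← integral_subtype_comap measurableSet_Ioi]
        refine integral_congr_ae (.of_forall fun r => ?_)
        simp only [sphereIntegral, F, NNReal.smul_def, smul_eq_mul]
        rw [Real.coe_toNNReal _ (pow_nonneg r.2.out.le _)]

theorem sphereIntegral_congr {r : ℝ} (hr : 0 ≤ r) {f g : Euc n → ℝ}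
    (h : ∀ x, ‖x‖ = r → f x = g x) : sphereIntegral r f = sphereIntegral r g := by
  unfold sphereIntegral
  congr 2
  ext y
  exact h _ (by simp [norm_smul, abs_of_nonneg hr])

/-- Radial factors are constant on spheres. This turns integrals against radial test functions on ℝⁿ
into integrals of spherical means against test functions on the ray. -/
theorem sphereIntegral_comp_norm_mul {r : ℝ} (hr : 0 ≤ r) (χ : ℝ → ℝ) (f : Euc n → ℝ) :
    sphereIntegral r (fun x => χ ‖x‖ * f x) = χ r * sphereIntegral r f := by
  rw [sphereIntegral_congr hr (g := fun x => χ r * f x) fun x hx => by rw [hx]]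
  simp only [sphereIntegral, integral_const_mul]
  ring

theorem continuousOn_sphereIntegral {R : ℝ} (hR : 0 ≤ R) {f : Euc n → ℝ}
    (hf : ContinuousOn f {x | R < ‖x‖}) : ContinuousOn (fun r => sphereIntegral r f) (Ioi R) := by
  refine (continuousOn_id.pow _).mul ?_
  rw [continuousOn_iff_continuous_domRestrict]
  have hmem : ∀ (r : Ioi R) (y : Metric.sphere (0 : Euc n) 1), r.1 • y.1 ∈ {x | R < ‖x‖} := by
    intro r y
    have : 0 < r.1 := hR.trans_lt r.2
    have hr : R < r.1 := r.2
    simpa [norm_smul, abs_of_pos this, -Subtype.coe_prop] using hr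
  have hc : Continuous (Function.uncurry fun (r : Ioi R) (y : Metric.sphere (0 : Euc n) 1) =>
      f (r.1 • y.1)) := by
    refine hf.comp_continuous (f := fun z : Ioi R × Metric.sphere (0 : Euc n) 1 => z.1.1 • z.2.1)
      (by fun_prop) fun z => hmem z.1 z.2
  have : LocallyCompactSpace (Ioi R) := isOpen_Ioi.locallyCompactSpace
  have := continuous_parametric_integral_of_continuous
    (μ := (volume : Measure (Euc n)).toSphere) hc isCompact_univ
  simpa [Set.domRestrict_def] using this

/-- The flux density `V · ν` through round spheres. -/
def radialPart (V : Fin n → Euc n → ℝ) (x : Euc n) : ℝ := ∑ j, V j x * (x j / ‖x‖)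

/-- The flat divergence. -/
def flatDiv (V : Fin n → Euc n → ℝ) (x : Euc n) : ℝ := ∑ j, pd j (V j) x

theorem isOpen_exterior (R : ℝ) : IsOpen {x : Euc n | R < ‖x‖} :=
  isOpen_lt continuous_const continuous_norm

theorem continuousOn_radialPart {R : ℝ} (hR : 0 ≤ R) {V : Fin n → Euc n → ℝ}
    (hV : ∀ j, ContinuousOn (V j) {x | R < ‖x‖}) :
    ContinuousOn (radialPart V) {x | R < ‖x‖} := by
  refine continuousOn_finsetSum _ fun j _ => (hV j).mul (ContinuousOn.div ?_ ?_ ?_)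
  · exact (by fun_prop : Continuous fun x : Euc n => x j).continuousOn
  · exact continuous_norm.continuousOn
  · intro x hx
    exact (hR.trans_lt hx).ne'

theorem contDiffOn_pd {m : ℕ} {U : Set (Euc n)} (hU : IsOpen U) {f : Euc n → ℝ}
    (hf : ContDiffOn ℝ (m + 1) f U) (i : Fin n) : ContDiffOn ℝ m (pd i f) U := by
  have h := hf.fderiv_of_isOpen hU (m := m) le_rfl
  exact h.clm_apply contDiffOn_const

theorem continuousOn_flatDiv {R : ℝ} {V : Fin n → Euc n → ℝ}
    (hV : ∀ j, ContDiffOn ℝ 1 (V j) {x | R < ‖x‖}) :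
    ContinuousOn (flatDiv V) {x | R < ‖x‖} :=
  continuousOn_finsetSum _ fun j _ =>
    (contDiffOn_pd (m := 0) (isOpen_exterior R) (by simpa using hV j) j).continuousOn

section Weak

variable {R : ℝ} (hR : 0 ≤ R) {χ : ℝ → ℝ} (h1 : ContDiff ℝ ∞ χ) (h2 : HasCompactSupport χ)
  (h3 : tsupport χ ⊆ Ioi R)

theorem tsupport_comp_norm_subset : tsupport (fun x : Euc n => χ ‖x‖) ⊆ norm ⁻¹' tsupport χ :=
  tsupport_comp_subset_preimage χ continuous_norm

include h2 in
theorem hasCompactSupport_comp_norm : HasCompactSupport (fun x : Euc n => χ ‖x‖) := by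
  obtain ⟨b, hb⟩ := h2.isCompact.isBounded.subset_closedBall 0
  refine HasCompactSupport.intro (isCompact_closedBall (0 : Euc n) b) fun x hx => ?_
  apply image_eq_zero_of_notMem_tsupport
  intro h
  apply hx
  simpa using hb h

include hR h1 h3 in
-- The norm is smooth away from the origin, and `χ` vanishes near 0 because its support lies in `Ioi
-- R` with `R ≥ 0`.
theorem contDiff_comp_norm : ContDiff ℝ ∞ (fun x : Euc n => χ ‖x‖) := by
  rw [contDiff_iff_contDiffAt]
  intro x
  by_cases hx : x = 0
  · have h0 : (0 : ℝ) ∉ tsupport χ := fun h => absurd (h3 h) (by simpa using hR)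
    have : (fun x : Euc n => χ ‖x‖) =ᶠ[𝓝 x] fun _ => 0 := by
      have h4 : ∀ᶠ t in 𝓝 (0 : ℝ), χ t = 0 := notMem_tsupport_iff_eventuallyEq.1 h0
      have h5 : Tendsto (fun x : Euc n => ‖x‖) (𝓝 x) (𝓝 0) := by
        simpa [hx] using (continuous_norm (E := Euc n)).tendsto 0
      exact h5.eventually h4
    exact contDiffAt_const.congr_of_eventuallyEq this
  · exact h1.contDiffAt.comp x (contDiffAt_norm ℝ hx)

include hR h1 h3 in
theorem pd_comp_norm (j : Fin n) (x : Euc n) :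
    pd j (fun x : Euc n => χ ‖x‖) x = deriv χ ‖x‖ * (x j / ‖x‖) := by
  by_cases hx : x = 0
  · subst hx
    have h0 : (0 : ℝ) ∉ tsupport χ := fun h => absurd (h3 h) (by simpa using hR)
    have h4 : χ =ᶠ[𝓝 0] fun _ => 0 := notMem_tsupport_iff_eventuallyEq.1 h0
    have h5 : Tendsto (fun x : Euc n => ‖x‖) (𝓝 0) (𝓝 0) := by
      simpa using (continuous_norm (E := Euc n)).tendsto 0
    have : (fun x : Euc n => χ ‖x‖) =ᶠ[𝓝 0] fun _ => 0 := h5.eventually h4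
    simp [pd, this.fderiv_eq]
  · have hn := (contDiffAt_norm (n := 1) ℝ hx).differentiableAt (by simp)
    have hχ : DifferentiableAt ℝ χ ‖x‖ := h1.differentiable (by simp) _
    have hd := hχ.hasDerivAt.comp_hasFDerivAt x hn.hasFDerivAt
    have hin : fderiv ℝ (fun y : Euc n => ‖y‖) x (EuclideanSpace.single j 1) = x j / ‖x‖ := by
      -- The gradient of the norm is read off from 2|x| ∂_j|x| = ∂_j|x|² = 2x_j.
      have hsq : HasFDerivAt (fun y : Euc n => ‖y‖ ^ 2) _ x := hn.hasFDerivAt.pow 2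
      have hsq' := (hasStrictFDerivAt_norm_sq x).hasFDerivAt
      have := congrArg (fun L => L (EuclideanSpace.single j (1 : ℝ))) (hsq.unique hsq')
      simp [EuclideanSpace.inner_single_right] at this
      have hx' : ‖x‖ ≠ 0 := norm_ne_zero_iff.2 hx
      field_simp
      linarith
    have : pd j (fun x : Euc n => χ ‖x‖) x =
      (deriv χ ‖x‖ • fderiv ℝ (fun y : Euc n => ‖y‖) x) (EuclideanSpace.single j 1) := by
      unfold pd
      exact congrArg (fun L => L (EuclideanSpace.single j (1 : ℝ))) hd.fderiv
    rw [this]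
    simp [hin]

include hR h1 h2 h3 in
/-- The divergence theorem against radial test functions. -/
theorem integral_comp_norm_mul_flatDiv {V : Fin n → Euc n → ℝ}
    (hV : ∀ j, ContDiffOn ℝ 1 (V j) {x | R < ‖x‖}) :
    ∫ x, χ ‖x‖ * flatDiv V x = - ∫ x, deriv χ ‖x‖ * radialPart V x := by
  have hf := contDiff_comp_norm (n := n) hR h1 h3
  have hfc := hasCompactSupport_comp_norm (n := n) h2
  have hfs : tsupport (fun x : Euc n => χ ‖x‖) ⊆ {x | R < ‖x‖} :=
    fun x hx => h3 (tsupport_comp_norm_subset hx)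
  have hpd : ∀ j, ContinuousOn (pd j (V j)) {x | R < ‖x‖} := fun j =>
    (contDiffOn_pd (m := 0) (isOpen_exterior R) (by simpa using hV j) j).continuousOn
  have i1 : ∀ j, Integrable (fun x => χ ‖x‖ * pd j (V j) x) := fun j =>
    integrable_mul_of_tsupport_subset hf.continuous hfc hfs (hpd j)
  have i2 : ∀ j, Integrable (fun x => pd j (fun x => χ ‖x‖) x * V j x) := fun j =>
    integrable_mul_of_tsupport_subset
      ((hf.continuous_fderiv (by simp)).clm_apply continuous_const)
      (hfc.fderiv_apply ℝ _) ((tsupport_fderiv_apply_subset ℝ _).trans hfs) (hV j).continuousOn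
  have key : ∀ j, ∫ x, χ ‖x‖ * pd j (V j) x = - ∫ x, pd j (fun x => χ ‖x‖) x * V j x := by
    intro j
    refine integral_mul_fderiv_eq_neg_fderiv_mul_of_integrable (i2 j) (i1 j) ?_ ?_ ?_
    · exact integrable_mul_of_tsupport_subset hf.continuous hfc hfs (hV j).continuousOn
    · exact fun x _ => hf.differentiable (by simp) x
    · exact fun x hx => ((hV j).contDiffAt ((isOpen_exterior R).mem_nhds (hfs hx))).differentiableAt
        (by simp)
  simp only [flatDiv, Finset.mul_sum]
  rw [integral_finsetSum _ fun j _ => i1 j, Finset.sum_congr rfl fun j _ => key j,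
    Finset.sum_neg_distrib, ← integral_finsetSum _ fun j _ => i2 j]
  congr 2
  ext x
  simp only [radialPart, Finset.mul_sum]
  refine Finset.sum_congr rfl fun j _ => ?_
  rw [pd_comp_norm hR h1 h3]
  ring

end Weak

theorem isCompact_annulus (a b : ℝ) : IsCompact {x : Euc n | a ≤ ‖x‖ ∧ ‖x‖ ≤ b} := by
  refine Metric.isCompact_of_isClosed_isBounded ?_ ?_
  · exact (isClosed_le continuous_const continuous_norm).inter
      (isClosed_le continuous_norm continuous_const)
  · exact (Metric.isBounded_closedBall (x := (0 : Euc n)) (r := b)).subset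
      fun x hx => by simpa using hx.2

theorem integrableOn_shell {R a b : ℝ} (ha : R < a) {f : Euc n → ℝ}
    (hf : ContinuousOn f {x | R < ‖x‖}) : IntegrableOn f {x | a < ‖x‖ ∧ ‖x‖ ≤ b} :=
  ((hf.mono fun _ hx => ha.trans_le hx.1).integrableOn_compact (isCompact_annulus a b)).mono_set
    fun _ hx => ⟨hx.1.le, hx.2⟩

theorem measurableSet_shell (a b : ℝ) : MeasurableSet {x : Euc n | a < ‖x‖ ∧ ‖x‖ ≤ b} :=
  (measurableSet_lt measurable_const measurable_norm).inter
    (measurableSet_le measurable_norm measurable_const)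

theorem setIntegral_shell (hn : 0 < n) {R a b : ℝ} (hR : 0 ≤ R) (ha : R < a) (hab : a ≤ b)
    {f : Euc n → ℝ} (hf : ContinuousOn f {x | R < ‖x‖}) :
    ∫ x in {x | a < ‖x‖ ∧ ‖x‖ ≤ b}, f x = ∫ r in a..b, sphereIntegral r f := by
  rw [← integral_indicator (measurableSet_shell a b),
    integral_eq_integral_sphereIntegral hn
      ((integrable_indicator_iff (measurableSet_shell a b)).2 (integrableOn_shell ha hf)),
    intervalIntegral.integral_of_le hab]
  have h : ∀ r ∈ Ioi (0 : ℝ), sphereIntegral r ({x : Euc n | a < ‖x‖ ∧ ‖x‖ ≤ b}.indicator f) =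
      (Ioc a b).indicator (fun r => sphereIntegral r f) r := by
    intro r hr
    have := sphereIntegral_comp_norm_mul hr.out.le ((Ioc a b).indicator fun _ => 1) f
    rw [sphereIntegral_congr hr.out.le
      (g := fun x => (Ioc a b).indicator (fun _ => (1 : ℝ)) ‖x‖ * f x), this]
    · by_cases hr' : r ∈ Ioc a b <;> simp [hr']
    · intro x _
      by_cases hx : a < ‖x‖ ∧ ‖x‖ ≤ b
      · simp [indicator, hx]
      · simp only [indicator, mem_ofPred_eq, mem_Ioc, hx, if_false, zero_mul]
  rw [setIntegral_congr_fun measurableSet_Ioi h, setIntegral_indicator measurableSet_Ioc]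
  congr 2
  exact inter_eq_right.2 fun r hr => (hR.trans_lt ha).trans hr.1

/-- The divergence theorem on a spherical shell. -/
theorem sphereIntegral_sub_sphereIntegral (hn : 0 < n) {R a b : ℝ} (hR : 0 ≤ R) (ha : R < a)
    (hab : a ≤ b) {V : Fin n → Euc n → ℝ} (hV : ∀ j, ContDiffOn ℝ 1 (V j) {x | R < ‖x‖}) :
    sphereIntegral b (radialPart V) - sphereIntegral a (radialPart V) =
      ∫ x in {x | a < ‖x‖ ∧ ‖x‖ ≤ b}, flatDiv V x := by
  have hrad := continuousOn_radialPart hR fun j => (hV j).continuousOn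
  have hdiv := continuousOn_flatDiv hV
  rw [setIntegral_shell hn hR ha hab hdiv]
  -- Integration by parts against χ(|x|) in ℝⁿ says that the spherical integral of the divergence is
  -- the weak derivative of the flux as a function of the radius. Both are continuous, so the
  -- fundamental theorem holds between any two radii.
  refine sub_eq_integral_of_weak_deriv (continuousOn_sphereIntegral hR hrad)
    (continuousOn_sphereIntegral hR hdiv) ?_ ha (ha.trans_le hab)
  intro χ h1 h2 h3
  have hw := integral_comp_norm_mul_flatDiv hR h1 h2 h3 hV
  have aux : ∀ (θ : ℝ → ℝ) (f : Euc n → ℝ), Continuous θ → HasCompactSupport θ →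
      tsupport θ ⊆ Ioi R → ContinuousOn f {x | R < ‖x‖} →
      ∫ x, θ ‖x‖ * f x = ∫ r, θ r * sphereIntegral r f := by
    intro θ f c1 c2 c3 hf
    have hi : Integrable fun x : Euc n => θ ‖x‖ * f x := integrable_mul_of_tsupport_subset
      (c1.comp continuous_norm) (hasCompactSupport_comp_norm c2)
      (fun x hx => c3 (tsupport_comp_norm_subset hx)) hf
    rw [integral_eq_integral_sphereIntegral hn hi,
      setIntegral_congr_fun measurableSet_Ioi fun r hr =>
        sphereIntegral_comp_norm_mul (le_of_lt hr) θ f]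
    refine setIntegral_eq_integral_of_forall_compl_eq_zero fun r hr => ?_
    rw [image_eq_zero_of_notMem_tsupport fun h => hr (hR.trans_lt (c3 h)), zero_mul]
  rw [← aux χ _ h1.continuous h2 h3 hdiv, ← aux (deriv χ) _ (h1.continuous_deriv (by simp))
    h2.deriv (tsupport_deriv_subset.trans h3) hrad]
  exact hw

end Polar

/-! ### Fluxes through large spheres and their limits -/

section Flux

variable {n : ℕ} {R : ℝ}

theorem measurableSet_exterior (a : ℝ) : MeasurableSet {x : Euc n | a < ‖x‖} :=
  (isOpen_exterior a).measurableSet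

theorem integrableOn_exterior_of_lintegral_ne_top {s : ℝ} (hs : R < s) {f : Euc n → ℝ}
    (hf : ContinuousOn f {x | R < ‖x‖}) (h : ∫⁻ x in {x | s < ‖x‖}, ‖f x‖ₑ ≠ ⊤) :
    IntegrableOn f {x | s < ‖x‖} :=
  ⟨(hf.mono fun _ hx => hs.trans hx).aestronglyMeasurable (measurableSet_exterior s),
    lt_top_iff_ne_top.2 h⟩

/-- If the divergence is integrable near infinity, then the fluxes through large spheres
converge. -/
theorem tendsto_flux (hn : 0 < n) (hR : 0 ≤ R) {V : Fin n → Euc n → ℝ}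
    (hV : ∀ j, ContDiffOn ℝ 1 (V j) {x | R < ‖x‖}) {a : ℝ} (ha : R < a)
    (hdiv : IntegrableOn (flatDiv V) {x | a < ‖x‖}) :
    Tendsto (fun r => sphereIntegral r (radialPart V)) atTop
      (𝓝 (sphereIntegral a (radialPart V) + ∫ x in {x | a < ‖x‖}, flatDiv V x)) := by
  have hU : (⋃ b : ℝ, {x : Euc n | a < ‖x‖ ∧ ‖x‖ ≤ b}) = {x | a < ‖x‖} := by
    ext x
    simp only [mem_iUnion]
    exact ⟨fun ⟨_, h⟩ => h.1, fun h => ⟨‖x‖, h, le_rfl⟩⟩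
  have hlim := tendsto_setIntegral_of_monotone (μ := volume) (f := flatDiv V)
    (s := fun b : ℝ => {x : Euc n | a < ‖x‖ ∧ ‖x‖ ≤ b})
    (fun b => measurableSet_shell a b)
    (fun b c hbc x hx => ⟨hx.1, hx.2.trans hbc⟩) (by rwa [hU])
  rw [hU] at hlim
  refine (tendsto_const_nhds.add hlim).congr' ?_
  filter_upwards [eventually_ge_atTop a] with b hb
  rw [← sphereIntegral_sub_sphereIntegral hn hR ha hb hV]
  ring

/-- The flux at infinity minus the flux at radius `a` is the integral of the divergence over the
exterior of the ball of radius `a`. -/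
theorem abs_sub_sphereIntegral_le (hn : 0 < n) (hR : 0 ≤ R) {V : Fin n → Euc n → ℝ}
    (hV : ∀ j, ContDiffOn ℝ 1 (V j) {x | R < ‖x‖}) {E s ε : ℝ} (hs : R < s) (hε : 0 ≤ ε)
    (hE : Tendsto (fun r => sphereIntegral r (radialPart V)) atTop (𝓝 E))
    (hdiv : ∫⁻ x in {x | s < ‖x‖}, ‖flatDiv V x‖ₑ ≤ ENNReal.ofReal ε) {a : ℝ} (ha : s < a) :
    |E - sphereIntegral a (radialPart V)| ≤ ε := by
  have hsub : {x : Euc n | a < ‖x‖} ⊆ {x | s < ‖x‖} := fun x hx => ha.trans hx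
  have hle : ∫⁻ x in {x | a < ‖x‖}, ‖flatDiv V x‖ₑ ≤ ENNReal.ofReal ε :=
    (lintegral_mono_set hsub).trans hdiv
  have hi := integrableOn_exterior_of_lintegral_ne_top (hs.trans ha) (continuousOn_flatDiv hV)
    (ne_top_of_le_ne_top ENNReal.ofReal_ne_top hle)
  rw [tendsto_nhds_unique hE (tendsto_flux hn hR hV (hs.trans ha) hi), add_sub_cancel_left,
    ← Real.norm_eq_abs]
  rw [← ENNReal.ofReal_le_ofReal_iff hε, ofReal_norm]
  exact (enorm_integral_le_lintegral_enorm _).trans hle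

/-- Averaging over the radii in (a, a+1] replaces a surface integral by a volume integral, which L¹
convergence of the fields controls without a trace theorem. The unit width makes the average equal
to the integral. -/
theorem abs_limit_sub_shell_le (hn : 0 < n) (hR : 0 ≤ R) {V : Fin n → Euc n → ℝ}
    (hV : ∀ j, ContDiffOn ℝ 1 (V j) {x | R < ‖x‖}) {E s ε : ℝ} (hs : R < s) (hε : 0 ≤ ε)
    (hE : Tendsto (fun r => sphereIntegral r (radialPart V)) atTop (𝓝 E))
    (hdiv : ∫⁻ x in {x | s < ‖x‖}, ‖flatDiv V x‖ₑ ≤ ENNReal.ofReal ε) {a : ℝ} (ha : s < a) :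
    |E - ∫ x in {x | a < ‖x‖ ∧ ‖x‖ ≤ a + 1}, radialPart V x| ≤ ε := by
  have hrad := continuousOn_radialPart hR fun j => (hV j).continuousOn
  rw [setIntegral_shell hn hR (hs.trans ha) (by linarith) hrad]
  have hI : IntervalIntegrable (fun r => sphereIntegral r (radialPart V)) volume a (a + 1) := by
    refine ((continuousOn_sphereIntegral hR hrad).mono ?_).intervalIntegrable
    rw [uIcc_of_le (by linarith)]
    exact fun r hr => (hs.trans ha).trans_le hr.1
  have : E - ∫ r in a..(a + 1), sphereIntegral r (radialPart V) =
      ∫ r in a..(a + 1), (E - sphereIntegral r (radialPart V)) := by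
    rw [intervalIntegral.integral_sub intervalIntegrable_const hI]
    simp
  rw [this, ← Real.norm_eq_abs]
  refine (intervalIntegral.norm_integral_le_of_norm_le_const (C := ε) fun r hr => ?_).trans
    (by simp)
  rw [uIoc_of_le (by linarith)] at hr
  exact abs_sub_sphereIntegral_le hn hR hV hs hε hE hdiv (ha.trans hr.1)

theorem enorm_radialPart_sub_le (V W : Fin n → Euc n → ℝ) (x : Euc n) :
    ‖radialPart V x - radialPart W x‖ₑ ≤ ∑ j, ‖V j x - W j x‖ₑ := by
  have : radialPart V x - radialPart W x = ∑ j, (V j x - W j x) * (x j / ‖x‖) := by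
    simp only [radialPart, sub_mul, Finset.sum_sub_distrib]
  rw [this]
  refine (enorm_sum_le _ _).trans (Finset.sum_le_sum fun j _ => ?_)
  rw [enorm_mul]
  refine mul_le_of_le_one_right' ?_
  rw [← ofReal_norm, ← ENNReal.ofReal_one]
  apply ENNReal.ofReal_le_ofReal
  rw [norm_div, norm_norm]
  exact div_le_one_of_le₀ (PiLp.norm_apply_le x j) (norm_nonneg _)

/-- Convergence of the flux at infinity, from locally `L¹` convergence of the fields and uniform
smallness of the divergences near infinity. -/
theorem tendsto_flux_limit (hn : 0 < n) (hR : 0 ≤ R) {V : ℕ → Fin n → Euc n → ℝ}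
    {W : Fin n → Euc n → ℝ} (hV : ∀ l j, ContDiffOn ℝ 1 (V l j) {x | R < ‖x‖})
    (hW : ∀ j, ContDiffOn ℝ 1 (W j) {x | R < ‖x‖}) {E : ℕ → ℝ} {E' : ℝ}
    (hE : ∀ l, Tendsto (fun r => sphereIntegral r (radialPart (V l))) atTop (𝓝 (E l)))
    (hE' : Tendsto (fun r => sphereIntegral r (radialPart W)) atTop (𝓝 E'))
    (hsmall : ∀ ε : ℝ, 0 < ε → ∃ s, R < s ∧
      (∀ᶠ l in atTop, ∫⁻ x in {x | s < ‖x‖}, ‖flatDiv (V l) x‖ₑ ≤ ENNReal.ofReal ε) ∧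
      ∫⁻ x in {x | s < ‖x‖}, ‖flatDiv W x‖ₑ ≤ ENNReal.ofReal ε)
    (hloc : ∀ a b, R < a → ∀ j, Tendsto (fun l => ∫⁻ x in {x | a ≤ ‖x‖ ∧ ‖x‖ ≤ b},
      ‖V l j x - W j x‖ₑ) atTop (𝓝 0)) :
    Tendsto E atTop (𝓝 E') := by
  rw [Metric.tendsto_atTop']
  intro ε hε
  -- Three errors of size ε/4 occur: the tail of `V l`, the tail of `W`, and the difference on the
  -- shell. Their sum stays strictly below ε.
  obtain ⟨s, hs, h1, h2⟩ := hsmall (ε / 4) (by linarith)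
  set a := s + 1 with ha
  have hsa : s < a := by linarith
  have hRa : R < a := hs.trans hsa
  have hsum : Tendsto (fun l => ∑ j, ∫⁻ x in {x | a ≤ ‖x‖ ∧ ‖x‖ ≤ a + 1}, ‖V l j x - W j x‖ₑ)
      atTop (𝓝 0) := by
    simpa using tendsto_finsetSum Finset.univ fun j _ => hloc a (a + 1) hRa j
  have h3 : ∀ᶠ l in atTop, ∑ j, ∫⁻ x in {x | a ≤ ‖x‖ ∧ ‖x‖ ≤ a + 1}, ‖V l j x - W j x‖ₑ ≤
      ENNReal.ofReal (ε / 4) :=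
    hsum.eventually_le_const (by simpa using hε)
  obtain ⟨N, hN⟩ := eventually_atTop.1 (h1.and h3)
  refine ⟨N, fun l hl => ?_⟩
  obtain ⟨h1l, h3l⟩ := hN l hl.le
  have e1 := abs_limit_sub_shell_le hn hR (hV l) hs (by linarith) (hE l) h1l hsa
  have e2 := abs_limit_sub_shell_le hn hR hW hs (by linarith) hE' h2 hsa
  have e3 : |(∫ x in {x | a < ‖x‖ ∧ ‖x‖ ≤ a + 1}, radialPart (V l) x) -
      ∫ x in {x | a < ‖x‖ ∧ ‖x‖ ≤ a + 1}, radialPart W x| ≤ ε / 4 := by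
    rw [← integral_sub
      (integrableOn_shell hRa (continuousOn_radialPart hR fun j => (hV l j).continuousOn))
      (integrableOn_shell hRa (continuousOn_radialPart hR fun j => (hW j).continuousOn)),
      ← Real.norm_eq_abs, ← ENNReal.ofReal_le_ofReal_iff (by linarith), ofReal_norm]
    refine (enorm_integral_le_lintegral_enorm _).trans (le_trans ?_ h3l)
    refine (lintegral_mono fun x => enorm_radialPart_sub_le (V l) W x).trans ?_
    rw [lintegral_finsetSum']
    · exact Finset.sum_le_sum fun j _ => lintegral_mono_set fun x hx => ⟨hx.1.le, hx.2⟩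
    · intro j _
      refine AEMeasurable.enorm ?_
      refine ContinuousOn.aemeasurable (((hV l j).continuousOn.sub (hW j).continuousOn).mono ?_)
        (measurableSet_shell a (a + 1))
      exact fun x hx => hRa.trans hx.1
  rw [Real.dist_eq]
  rw [abs_le] at e1 e2 e3
  rw [abs_lt]
  constructor <;> linarith [e1.1, e1.2, e2.1, e2.2, e3.1, e3.2]

end Flux

/-! ### Rules for partial derivatives -/

section Derivatives

variable {n : ℕ}

theorem pd_add {i : Fin n} {f g : Euc n → ℝ} {x : Euc n} (hf : DifferentiableAt ℝ f x)
    (hg : DifferentiableAt ℝ g x) : pd i (fun y => f y + g y) x = pd i f x + pd i g x := by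
  simp [pd, fderiv_fun_add hf hg]

theorem pd_sub {i : Fin n} {f g : Euc n → ℝ} {x : Euc n} (hf : DifferentiableAt ℝ f x)
    (hg : DifferentiableAt ℝ g x) : pd i (fun y => f y - g y) x = pd i f x - pd i g x := by
  simp [pd, fderiv_fun_sub hf hg]

theorem pd_mul {i : Fin n} {f g : Euc n → ℝ} {x : Euc n} (hf : DifferentiableAt ℝ f x)
    (hg : DifferentiableAt ℝ g x) :
    pd i (fun y => f y * g y) x = pd i f x * g x + f x * pd i g x := by
  simp [pd, fderiv_fun_mul hf hg]
  ring

theorem pd_const_mul {i : Fin n} {f : Euc n → ℝ} {x : Euc n} (c : ℝ)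
    (hf : DifferentiableAt ℝ f x) : pd i (fun y => c * f y) x = c * pd i f x := by
  simp [pd, fderiv_const_mul hf]

theorem pd_sum {ι : Type*} {i : Fin n} {u : Finset ι} {f : ι → Euc n → ℝ} {x : Euc n}
    (hf : ∀ a ∈ u, DifferentiableAt ℝ (f a) x) :
    pd i (fun y => ∑ a ∈ u, f a y) x = ∑ a ∈ u, pd i (f a) x := by
  simp [pd, fderiv_fun_sum hf]

theorem pd_sub_const (i : Fin n) (f : Euc n → ℝ) (c : ℝ) : pd i (fun y => f y - c) = pd i f := by
  ext x
  simp [pd, fderiv_sub_const]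

theorem pd_const (i : Fin n) (c : ℝ) (x : Euc n) : pd i (fun _ => c) x = 0 := by
  simp [pd]

theorem differentiableAt_pd {f : Euc n → ℝ} {x : Euc n} (hf : ContDiffAt ℝ 2 f x) (i : Fin n) :
    DifferentiableAt ℝ (pd i f) x := by
  have h := hf.fderiv_right (m := 1) (by norm_num)
  exact (h.differentiableAt (by simp)).clm_apply (differentiableAt_const _)

end Derivatives

/-! ### The inverse metric near the flat one -/

section Inverse

variable {n : ℕ}

/-- Since nh ≤ 1/2, the matrix is strictly diagonally dominant. The identity A⁻¹ - 1 = -(A - 1)A⁻¹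
then gives, for the largest entry m of A⁻¹ in absolute value, m ≤ 1 + m/2, so m ≤ 2; inserting this
in the same identity gives the last bound. -/
theorem inv_bounds_of_near_one {A : Matrix (Fin n) (Fin n) ℝ} {h : ℝ}
    (hA : ∀ i j, |A i j - (1 : Matrix (Fin n) (Fin n) ℝ) i j| ≤ h) (hh : h ≤ 1 / (2 * n)) :
    A.det ≠ 0 ∧ (∀ i j, |A⁻¹ i j| ≤ 2) ∧
      ∀ i j, |A⁻¹ i j - (1 : Matrix (Fin n) (Fin n) ℝ) i j| ≤ 2 * n * h := by
  rcases Nat.eq_zero_or_pos n with rfl | hn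
  · exact ⟨by simp, fun i => i.elim0, fun i => i.elim0⟩
  have hn' : (0 : ℝ) < n := by exact_mod_cast hn
  have i0 : Fin n := ⟨0, hn⟩
  have h0 : 0 ≤ h := (abs_nonneg _).trans (hA i0 i0)
  have hnh : n * h ≤ 1 / 2 := by
    calc n * h ≤ n * (1 / (2 * n)) := by gcongr
      _ = 1 / 2 := by field_simp
  have hdet : A.det ≠ 0 := by
    apply det_ne_zero_of_sum_row_lt_diag
    intro k
    have h1 : ∑ j ∈ Finset.univ.erase k, ‖A k j‖ ≤ ∑ j ∈ Finset.univ.erase k, h := by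
      refine Finset.sum_le_sum fun j hj => ?_
      have := hA k j
      rwa [Matrix.one_apply_ne (Finset.ne_of_mem_erase hj).symm, sub_zero] at this
    have h2 : 1 - h ≤ ‖A k k‖ := by
      have := hA k k
      rw [Matrix.one_apply_eq, abs_sub_comm] at this
      have h3 := (abs_sub_abs_le_abs_sub 1 (A k k)).trans this
      rw [abs_one] at h3
      rw [Real.norm_eq_abs]
      linarith
    rw [Finset.sum_const, Finset.card_erase_of_mem (Finset.mem_univ _), Finset.card_univ,
      Fintype.card_fin, nsmul_eq_mul, Nat.cast_sub hn] at h1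
    push_cast at h1
    have : (n - 1) * h = n * h - h := by ring
    linarith
  have hinv : ∀ i j, A⁻¹ i j - (1 : Matrix (Fin n) (Fin n) ℝ) i j =
      -∑ a, (A i a - (1 : Matrix (Fin n) (Fin n) ℝ) i a) * A⁻¹ a j := by
    intro i j
    have h1 : (A - 1) * A⁻¹ = 1 - A⁻¹ := by
      rw [sub_mul, Matrix.mul_nonsing_inv A (isUnit_iff_ne_zero.2 hdet), one_mul]
    have h2 := congrFun (congrFun h1 i) j
    rw [Matrix.mul_apply] at h2
    simp only [Matrix.sub_apply] at h2
    rw [h2]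
    ring
  have hbound : ∀ m : ℝ, (∀ i j, |A⁻¹ i j| ≤ m) →
      ∀ i j, |A⁻¹ i j - (1 : Matrix (Fin n) (Fin n) ℝ) i j| ≤ n * h * m := by
    intro m hm i j
    rw [hinv, abs_neg]
    refine (Finset.abs_sum_le_sum_abs _ _).trans ?_
    calc ∑ a, |(A i a - (1 : Matrix (Fin n) (Fin n) ℝ) i a) * A⁻¹ a j| ≤ ∑ _a : Fin n, h * m := by
          refine Finset.sum_le_sum fun a _ => ?_
          rw [abs_mul]
          exact mul_le_mul (hA i a) (hm a j) (abs_nonneg _) h0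
      _ = n * h * m := by simp; ring
  have h2 : ∀ i j, |A⁻¹ i j| ≤ 2 := by
    obtain ⟨⟨a, b⟩, -, hab⟩ := Finset.exists_max_image (Finset.univ : Finset (Fin n × Fin n))
      (fun z => |A⁻¹ z.1 z.2|) ⟨(i0, i0), Finset.mem_univ _⟩
    have hm : ∀ i j, |A⁻¹ i j| ≤ |A⁻¹ a b| := fun i j => hab (i, j) (Finset.mem_univ _)
    have h3 := hbound _ hm a b
    have h4 : |(1 : Matrix (Fin n) (Fin n) ℝ) a b| ≤ 1 := by
      rw [Matrix.one_apply]; split_ifs <;> simp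
    have h5 := abs_sub_abs_le_abs_sub (A⁻¹ a b) ((1 : Matrix (Fin n) (Fin n) ℝ) a b)
    have h6 : n * h * |A⁻¹ a b| ≤ 1 / 2 * |A⁻¹ a b| := by gcongr
    intro i j
    have := hm i j
    linarith
  refine ⟨hdet, h2, fun i j => ?_⟩
  have := hbound 2 h2 i j
  linarith

theorem differentiableAt_det {G : Components n} {x : Euc n}
    (hG : ∀ i j, DifferentiableAt ℝ (fun y => G y i j) x) :
    DifferentiableAt ℝ (fun y => (G y).det) x := by
  simp only [Matrix.det_apply']
  refine DifferentiableAt.fun_sum fun σ _ => (differentiableAt_const _).mul ?_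
  exact (HasFDerivAt.finsetProd fun i _ => (hG (σ i) i).hasFDerivAt).differentiableAt

theorem differentiableAt_inv {G : Components n} {x : Euc n}
    (hG : ∀ i j, DifferentiableAt ℝ (fun y => G y i j) x) (hdet : (G x).det ≠ 0) (i j : Fin n) :
    DifferentiableAt ℝ (fun y => (G y)⁻¹ i j) x := by
  simp only [Matrix.inv_def, Matrix.smul_apply, smul_eq_mul, Ring.inverse_eq_inv',
    Matrix.adjugate_apply]
  -- Cramer's rule: the cofactor is the determinant of `G` with row `j` replaced by a constant
  -- vector, so its entries are again differentiable.
  refine ((differentiableAt_det hG).inv hdet).mul (differentiableAt_det fun a b => ?_)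
  by_cases ha : a = j
  · subst ha
    simp
  · simpa [Matrix.updateRow_ne ha] using hG a b

/-- Differentiation of G G⁻¹ = 1, which holds in a neighbourhood because a nonzero determinant is an
open condition. -/
theorem pd_inv {G : Components n} {x : Euc n}
    (hG : ∀ i j, DifferentiableAt ℝ (fun y => G y i j) x) (hdet : (G x).det ≠ 0) (k i j : Fin n) :
    pd k (fun y => (G y)⁻¹ i j) x =
      -∑ a, ∑ b, (G x)⁻¹ i a * pd k (fun y => G y a b) x * (G x)⁻¹ b j := by
  have hP := differentiableAt_inv hG hdet
  let dG : Matrix (Fin n) (Fin n) ℝ := Matrix.of fun a b => pd k (fun y => G y a b) x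
  let dP : Matrix (Fin n) (Fin n) ℝ := Matrix.of fun a b => pd k (fun y => (G y)⁻¹ a b) x
  have hmul : dG * (G x)⁻¹ + G x * dP = 0 := by
    ext a b
    have hev : (fun y => ∑ c, G y a c * (G y)⁻¹ c b) =ᶠ[𝓝 x]
        fun _ => (1 : Matrix (Fin n) (Fin n) ℝ) a b := by
      filter_upwards [(differentiableAt_det hG).continuousAt.eventually_ne hdet] with y hy
      rw [← Matrix.mul_apply, Matrix.mul_nonsing_inv _ (isUnit_iff_ne_zero.2 hy)]
    have h1 : pd k (fun y => ∑ c, G y a c * (G y)⁻¹ c b) x = 0 := by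
      unfold pd
      rw [hev.fderiv_eq]
      simp
    rw [pd_sum fun c _ => (hG a c).fun_mul (hP c b)] at h1
    simp only [pd_mul (hG a _) (hP _ b), Finset.sum_add_distrib] at h1
    simpa [Matrix.add_apply, Matrix.mul_apply, dG, dP] using h1
  have hdP : dP = -((G x)⁻¹ * dG * (G x)⁻¹) := by
    have h2 : (G x)⁻¹ * (G x * dP) = dP := by
      rw [← Matrix.mul_assoc, Matrix.nonsing_inv_mul _ (isUnit_iff_ne_zero.2 hdet), one_mul]
    rw [← h2, eq_neg_of_add_eq_zero_right hmul, Matrix.mul_neg, Matrix.mul_assoc]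
  have h3 := congrFun (congrFun hdP i) j
  simp only [Matrix.neg_apply, Matrix.mul_apply, dP, dG, Matrix.of_apply, Finset.sum_mul] at h3
  rw [h3, Finset.sum_comm]

end Inverse

/-! ### Derivatives of the Christoffel symbols and of the momentum tensor -/

section Formulas

variable {n : ℕ}

/-- The Christoffel symbols with lowered index, `2 Γₗᵢⱼ = ∂ᵢ gⱼₗ + ∂ⱼ gᵢₗ - ∂ₗ gᵢⱼ`. -/
def lowered (G : Components n) (i j l : Fin n) : Euc n → ℝ :=
  fun x => pd i (fun y => G y j l) x + pd j (fun y => G y i l) x - pd l (fun y => G y i j) x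

theorem differentiableAt_lowered {G : Components n} {x : Euc n}
    (hG : ∀ i j, ContDiffAt ℝ 2 (fun y => G y i j) x) (i j l : Fin n) :
    DifferentiableAt ℝ (lowered G i j l) x :=
  ((differentiableAt_pd (hG j l) i).fun_add (differentiableAt_pd (hG i l) j)).fun_sub (differentiableAt_pd (hG i j) l)

theorem pd_lowered {G : Components n} {x : Euc n}
    (hG : ∀ i j, ContDiffAt ℝ 2 (fun y => G y i j) x) (m i j l : Fin n) :
    pd m (lowered G i j l) x = pd m (pd i fun y => G y j l) x + pd m (pd j fun y => G y i l) x -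
      pd m (pd l fun y => G y i j) x := by
  unfold lowered
  rw [pd_sub ((differentiableAt_pd (hG j l) i).fun_add (differentiableAt_pd (hG i l) j))
    (differentiableAt_pd (hG i j) l), pd_add (differentiableAt_pd (hG j l) i)
    (differentiableAt_pd (hG i l) j)]

theorem pd_christoffel {G : Components n} {x : Euc n}
    (hG : ∀ i j, ContDiffAt ℝ 2 (fun y => G y i j) x) (hdet : (G x).det ≠ 0) (m k i j : Fin n) :
    pd m (christoffel G k i j) x = 1 / 2 * ∑ l, (pd m (fun y => (G y)⁻¹ k l) x * lowered G i j l x +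
      (G x)⁻¹ k l * pd m (lowered G i j l) x) := by
  have hP := differentiableAt_inv (fun i j => (hG i j).differentiableAt (by simp)) hdet
  have hL := differentiableAt_lowered hG i j
  have : christoffel G k i j = fun y => 1 / 2 * ∑ l, (G y)⁻¹ k l * lowered G i j l y := rfl
  rw [this, pd_const_mul _ (DifferentiableAt.fun_sum fun l _ => (hP k l).fun_mul (hL l)),
    pd_sum fun l _ => (hP k l).fun_mul (hL l)]
  simp only [pd_mul (hP k _) (hL _)]

/-- The field `Vⱼ = ∑ᵢ (∂ᵢ gᵢⱼ - ∂ⱼ gᵢᵢ)` whose flux at infinity is the energy. -/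
def energyField (G : Components n) (j : Fin n) : Euc n → ℝ :=
  fun x => ∑ i, (pd i (fun y => G y i j) x - pd j (fun y => G y i i) x)

/-- The linearised momentum tensor `kᵢⱼ - (∑ₐ kₐₐ) δᵢⱼ`. -/
def momentumField (K : Components n) (i j : Fin n) : Euc n → ℝ :=
  fun x => K x i j - (∑ a, K x a a) * (1 : Matrix (Fin n) (Fin n) ℝ) i j

theorem flatDiv_energyField {G : Components n} {x : Euc n}
    (hG : ∀ i j, ContDiffAt ℝ 2 (fun y => G y i j) x) :
    flatDiv (energyField G) x =
      ∑ j, ∑ i, (pd j (pd i fun y => G y i j) x - pd j (pd j fun y => G y i i) x) := by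
  unfold flatDiv energyField
  refine Finset.sum_congr rfl fun j _ => ?_
  rw [pd_sum fun i _ => (differentiableAt_pd (hG i j) i).fun_sub (differentiableAt_pd (hG i i) j)]
  exact Finset.sum_congr rfl fun i _ =>
    pd_sub (differentiableAt_pd (hG i j) i) (differentiableAt_pd (hG i i) j)

theorem pd_momentumField {K : Components n} {x : Euc n}
    (hK : ∀ i j, DifferentiableAt ℝ (fun y => K y i j) x) (k i j : Fin n) :
    pd k (momentumField K i j) x = pd k (fun y => K y i j) x -
      (∑ a, pd k (fun y => K y a a) x) * (1 : Matrix (Fin n) (Fin n) ℝ) i j := by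
  have hs : DifferentiableAt ℝ (fun y => ∑ a, K y a a) x :=
    DifferentiableAt.fun_sum fun a _ => hK a a
  unfold momentumField
  rw [pd_sub (hK i j) (hs.mul_const _), pd_mul hs (differentiableAt_const _),
    pd_sum fun a _ => hK a a, pd_const, mul_zero, add_zero]

theorem differentiableAt_traceWrt {G K : Components n} {x : Euc n}
    (hG : ∀ i j, DifferentiableAt ℝ (fun y => G y i j) x)
    (hK : ∀ i j, DifferentiableAt ℝ (fun y => K y i j) x) (hdet : (G x).det ≠ 0) :
    DifferentiableAt ℝ (traceWrt G K) x :=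
  DifferentiableAt.fun_sum fun a _ => DifferentiableAt.fun_sum fun b _ =>
    (differentiableAt_inv hG hdet a b).fun_mul (hK a b)

theorem pd_traceWrt {G K : Components n} {x : Euc n}
    (hG : ∀ i j, DifferentiableAt ℝ (fun y => G y i j) x)
    (hK : ∀ i j, DifferentiableAt ℝ (fun y => K y i j) x) (hdet : (G x).det ≠ 0) (k : Fin n) :
    pd k (traceWrt G K) x = ∑ a, ∑ b, (pd k (fun y => (G y)⁻¹ a b) x * K x a b +
      (G x)⁻¹ a b * pd k (fun y => K y a b) x) := by
  have hP := differentiableAt_inv hG hdet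
  unfold traceWrt
  rw [pd_sum fun a _ => DifferentiableAt.fun_sum fun b _ => (hP a b).fun_mul (hK a b)]
  refine Finset.sum_congr rfl fun a _ => ?_
  rw [pd_sum fun b _ => (hP a b).fun_mul (hK a b)]
  exact Finset.sum_congr rfl fun b _ => pd_mul (hP a b) (hK a b)

theorem pd_momentumTensor {G K : Components n} {x : Euc n}
    (hG : ∀ i j, DifferentiableAt ℝ (fun y => G y i j) x)
    (hK : ∀ i j, DifferentiableAt ℝ (fun y => K y i j) x) (hdet : (G x).det ≠ 0) (k i j : Fin n) :
    pd k (fun y => momentumTensor G K y i j) x = pd k (fun y => K y i j) x -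
      (pd k (traceWrt G K) x * G x i j + traceWrt G K x * pd k (fun y => G y i j) x) := by
  have ht := differentiableAt_traceWrt hG hK hdet
  have : (fun y => momentumTensor G K y i j) = fun y => K y i j - traceWrt G K y * G y i j := rfl
  rw [this, pd_sub (hK i j) (ht.fun_mul (hG i j)), pd_mul ht (hG i j)]

end Formulas

/-! ### The constraints equal their linearisation up to quadratic errors -/

section Estimates

variable {n : ℕ} {ι : Type*} {F : Filter ι}

local notation "δ" => (1 : Matrix (Fin n) (Fin n) ℝ)

theorem one_apply_isBigO (i j : Fin n) :
    (fun _ : ι => δ i j) =O[F] fun _ => (1 : ℝ) :=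
  Asymptotics.isBigO_const_const _ one_ne_zero _

/-- A family of components `G t` at points `x t` which is near the flat metric, with bounds
`h`, `d` on the deviation and on the first derivatives. -/
structure NearFlat (F : Filter ι) (G : ι → Components n) (x : ι → Euc n) (h d : ι → ℝ) :
    Prop where
  diff : ∀ᶠ t in F, ∀ i j, DifferentiableAt ℝ (fun y => G t y i j) (x t)
  near : ∀ᶠ t in F, (∀ i j, |G t (x t) i j - δ i j| ≤ h t) ∧ h t ≤ 1 / (2 * n)
  h_nonneg : ∀ t, 0 ≤ h t
  d_nonneg : ∀ t, 0 ≤ d t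
  pd_isBigO : ∀ k i j, (fun t => pd k (fun y => G t y i j) (x t)) =O[F] d

namespace NearFlat

variable {G K : ι → Components n} {x : ι → Euc n} {h d d₂ κ κ₁ : ι → ℝ} (H : NearFlat F G x h d)

include H

theorem det_ne_zero : ∀ᶠ t in F, (G t (x t)).det ≠ 0 :=
  H.near.mono fun _ ht => (inv_bounds_of_near_one ht.1 ht.2).1

theorem inv_isBigO (i j : Fin n) : (fun t => (G t (x t))⁻¹ i j) =O[F] fun _ => (1 : ℝ) :=
  .of_bound 2 <| H.near.mono fun _ ht => by
    simpa using (inv_bounds_of_near_one ht.1 ht.2).2.1 i j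

theorem inv_sub_isBigO (i j : Fin n) : (fun t => (G t (x t))⁻¹ i j - δ i j) =O[F] h :=
  .of_bound (2 * n) <| H.near.mono fun t ht => by
    rw [Real.norm_eq_abs, Real.norm_eq_abs, abs_of_nonneg (H.h_nonneg t)]
    exact (inv_bounds_of_near_one ht.1 ht.2).2.2 i j

theorem sub_isBigO (i j : Fin n) : (fun t => G t (x t) i j - δ i j) =O[F] h :=
  .of_bound 1 <| H.near.mono fun t ht => by
    rw [Real.norm_eq_abs, Real.norm_eq_abs, abs_of_nonneg (H.h_nonneg t), one_mul]
    exact ht.1 i j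

theorem h_isBigO_one : h =O[F] fun _ => (1 : ℝ) :=
  .of_bound (1 / (2 * n)) <| H.near.mono fun t ht => by
    rw [Real.norm_eq_abs, abs_of_nonneg (H.h_nonneg t), norm_one, mul_one]
    exact ht.2

theorem apply_isBigO (i j : Fin n) : (fun t => G t (x t) i j) =O[F] fun _ => (1 : ℝ) := by
  simpa using ((H.sub_isBigO i j).trans H.h_isBigO_one).add (one_apply_isBigO (F := F) i j)

theorem pd_inv_isBigO (k i j : Fin n) :
    (fun t => pd k (fun y => (G t y)⁻¹ i j) (x t)) =O[F] d := by
  have h1 : (fun t => -∑ a, ∑ b, (G t (x t))⁻¹ i a * pd k (fun y => G t y a b) (x t) *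
      (G t (x t))⁻¹ b j) =O[F] d := by
    refine (Asymptotics.IsBigO.fun_sum fun a _ => .fun_sum fun b _ => ?_).neg_left
    simpa using ((H.inv_isBigO i a).mul (H.pd_isBigO k a b)).mul (H.inv_isBigO b j)
  refine h1.congr' ?_ .rfl
  filter_upwards [H.diff, H.det_ne_zero] with t h1 h2
  exact (pd_inv h1 h2 k i j).symm

theorem lowered_isBigO (i j l : Fin n) : (fun t => lowered (G t) i j l (x t)) =O[F] d :=
  ((H.pd_isBigO i j l).add (H.pd_isBigO j i l)).sub (H.pd_isBigO l i j)

theorem christoffel_isBigO (k i j : Fin n) : (fun t => christoffel (G t) k i j (x t)) =O[F] d := by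
  refine (Asymptotics.IsBigO.fun_sum fun l _ => ?_).const_mul_left _
  exact ((H.inv_isBigO k l).mul (H.lowered_isBigO i j l)).congr_right fun t => one_mul _

section Curvature

variable (hG : ∀ᶠ t in F, ∀ i j, ContDiffAt ℝ 2 (fun y => G t y i j) (x t))
  (hd₂ : ∀ k l i j, (fun t => pd k (pd l fun y => G t y i j) (x t)) =O[F] d₂)
  (hd₂' : ∀ t, 0 ≤ d₂ t)

include hd₂' in
theorem mul_isBigO_error : (fun t => h t * d₂ t) =O[F] fun t => h t * d₂ t + d t ^ 2 :=
  .of_bound 1 <| .of_forall fun t => by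
    have := H.h_nonneg t
    have := hd₂' t
    have h1 : 0 ≤ h t * d₂ t := by positivity
    have h2 : 0 ≤ d t ^ 2 := by positivity
    rw [Real.norm_eq_abs, Real.norm_eq_abs, abs_of_nonneg h1, abs_of_nonneg (by positivity)]
    linarith

include hd₂' in
theorem sq_isBigO_error : (fun t => d t * d t) =O[F] fun t => h t * d₂ t + d t ^ 2 :=
  .of_bound 1 <| .of_forall fun t => by
    have := H.h_nonneg t
    have := hd₂' t
    have h1 : 0 ≤ h t * d₂ t := by positivity
    have h2 : 0 ≤ d t ^ 2 := by positivity
    rw [← sq, Real.norm_eq_abs, Real.norm_eq_abs, abs_of_nonneg h2, abs_of_nonneg (by positivity)]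
    linarith

include hG hd₂

omit H in
theorem pd_lowered_isBigO (m i j l : Fin n) :
    (fun t => pd m (lowered (G t) i j l) (x t)) =O[F] d₂ :=
  (((hd₂ m i j l).add (hd₂ m j i l)).sub (hd₂ m l i j)).congr'
    (hG.mono fun _ ht => (pd_lowered ht m i j l).symm) .rfl

include hd₂'

/-- In the product rule, the derivative falling on g⁻¹ gives a term of size d·d, and replacing g⁻¹
by δ in the other term costs h·d₂. -/
theorem pd_christoffel_isBigO (m k i j : Fin n) :
    (fun t => pd m (christoffel (G t) k i j) (x t) - 1 / 2 * pd m (lowered (G t) i j k) (x t))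
      =O[F] fun t => h t * d₂ t + d t ^ 2 := by
  have h1 : (fun t => 1 / 2 * ∑ l, (pd m (fun y => (G t y)⁻¹ k l) (x t) * lowered (G t) i j l (x t) +
      ((G t (x t))⁻¹ k l - δ k l) * pd m (lowered (G t) i j l) (x t)))
      =O[F] fun t => h t * d₂ t + d t ^ 2 := by
    refine (Asymptotics.IsBigO.fun_sum fun l _ => .add ?_ ?_).const_mul_left _
    · exact ((H.pd_inv_isBigO m k l).mul (H.lowered_isBigO i j l)).trans (H.sq_isBigO_error hd₂')
    · exact ((H.inv_sub_isBigO k l).mul (pd_lowered_isBigO hG hd₂ m i j l)).trans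
        (H.mul_isBigO_error hd₂')
  refine h1.congr' ?_ .rfl
  filter_upwards [hG, H.det_ne_zero] with t ht hdet
  rw [pd_christoffel ht hdet]
  simp only [sub_mul, Finset.sum_add_distrib, Finset.sum_sub_distrib]
  simp [Matrix.one_apply]
  ring

/-- The Ricci curvature agrees with its linearisation up to quadratic errors. -/
theorem ricci_isBigO (i j : Fin n) :
    (fun t => ricci (G t) i j (x t) - ∑ k, (1 / 2 * pd k (lowered (G t) i j k) (x t) -
      1 / 2 * pd j (lowered (G t) i k k) (x t))) =O[F] fun t => h t * d₂ t + d t ^ 2 := by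
  have h1 := Asymptotics.IsBigO.fun_sum (s := Finset.univ) fun k (_ : k ∈ Finset.univ) =>
    (H.pd_christoffel_isBigO hG hd₂ hd₂' k k i j).sub
      (H.pd_christoffel_isBigO hG hd₂ hd₂' j k i k)
  have h2 : (fun t => ∑ k, ∑ l, (christoffel (G t) k k l (x t) * christoffel (G t) l i j (x t) -
      christoffel (G t) k j l (x t) * christoffel (G t) l i k (x t)))
      =O[F] fun t => h t * d₂ t + d t ^ 2 := by
    refine Asymptotics.IsBigO.fun_sum fun k _ => .fun_sum fun l _ => .sub ?_ ?_ <;>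
    exact ((H.christoffel_isBigO _ _ _).mul (H.christoffel_isBigO _ _ _)).trans
      (H.sq_isBigO_error hd₂')
  refine (h1.add h2).congr_left fun t => ?_
  simp only [ricci, Finset.sum_sub_distrib]
  ring

/-- The scalar curvature agrees with its linearisation up to quadratic errors. -/
theorem scalarCurvature_isBigO :
    (fun t => scalarCurvature (G t) (x t) - flatDiv (energyField (G t)) (x t))
      =O[F] fun t => h t * d₂ t + d t ^ 2 := by
  set r : Fin n → Fin n → ι → ℝ := fun i j t =>
    ∑ k, (1 / 2 * pd k (lowered (G t) i j k) (x t) - 1 / 2 * pd j (lowered (G t) i k k) (x t))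
    with hr
  have hrO : ∀ i j, r i j =O[F] d₂ := fun i j => .fun_sum fun k _ =>
    ((pd_lowered_isBigO hG hd₂ k i j k).const_mul_left _).sub
      ((pd_lowered_isBigO hG hd₂ j i k k).const_mul_left _)
  have h1 : (fun t => ∑ i, ∑ j, ((G t (x t))⁻¹ i j * (ricci (G t) i j (x t) - r i j t) +
      ((G t (x t))⁻¹ i j - δ i j) * r i j t)) =O[F] fun t => h t * d₂ t + d t ^ 2 := by
    refine .fun_sum fun i _ => .fun_sum fun j _ => .add ?_ ?_
    · exact ((H.inv_isBigO i j).mul (H.ricci_isBigO hG hd₂ hd₂' i j)).congr_right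
        fun t => one_mul _
    · exact ((H.inv_sub_isBigO i j).mul (hrO i j)).trans (H.mul_isBigO_error hd₂')
  refine h1.congr' ?_ .rfl
  filter_upwards [hG] with t ht
  -- The trace of the linearised Ricci tensor is div V after relabelling summation indices; neither
  -- the symmetry of g nor that of second derivatives is needed.
  have e1 : flatDiv (energyField (G t)) (x t) = ∑ i, r i i t := by
    rw [flatDiv_energyField ht]
    simp only [hr, pd_lowered ht, Finset.sum_sub_distrib, Finset.sum_add_distrib,
      ← Finset.mul_sum]
    have e2 : ∑ j, ∑ i, pd j (pd i fun y => G t y i j) (x t) =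
        ∑ i, ∑ k, pd k (pd i fun y => G t y i k) (x t) := Finset.sum_comm
    have e3 : ∑ i, ∑ k, pd k (pd k fun y => G t y i i) (x t) =
        ∑ k, ∑ i, pd k (pd k fun y => G t y i i) (x t) := Finset.sum_comm
    rw [e2, e3]
    ring
  rw [e1]
  have e4 : ∑ i, r i i t = ∑ i, ∑ j, δ i j * r i j t := by simp [Matrix.one_apply]
  rw [e4]
  unfold scalarCurvature
  rw [← Finset.sum_sub_distrib]
  refine Finset.sum_congr rfl fun i _ => ?_
  rw [← Finset.sum_sub_distrib]
  exact Finset.sum_congr rfl fun j _ => by ring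

end Curvature

section SecondFundamentalForm

variable (hκ : ∀ i j, (fun t => K t (x t) i j) =O[F] κ)

include hκ

theorem traceWrt_isBigO : (fun t => traceWrt (G t) (K t) (x t)) =O[F] κ :=
  .fun_sum fun i _ => .fun_sum fun j _ => by simpa using (H.inv_isBigO i j).mul (hκ i j)

theorem normSqWrt_isBigO : (fun t => normSqWrt (G t) (K t) (x t)) =O[F] fun t => κ t ^ 2 := by
  refine .fun_sum fun i _ => .fun_sum fun j _ => .fun_sum fun a _ => .fun_sum fun b _ => ?_
  simpa [sq] using
    (((H.inv_isBigO i a).mul (H.inv_isBigO j b)).mul (hκ i j)).mul (hκ a b)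

theorem momentumTensor_isBigO (i j : Fin n) :
    (fun t => momentumTensor (G t) (K t) (x t) i j) =O[F] κ := by
  refine (hκ i j).sub ?_
  simpa using (H.traceWrt_isBigO hκ).mul (H.apply_isBigO i j)

theorem traceWrt_sub_isBigO :
    (fun t => traceWrt (G t) (K t) (x t) - ∑ a, K t (x t) a a) =O[F] fun t => h t * κ t := by
  have h1 : (fun t => ∑ i, ∑ j, ((G t (x t))⁻¹ i j - δ i j) * K t (x t) i j)
      =O[F] fun t => h t * κ t :=
    .fun_sum fun i _ => .fun_sum fun j _ => (H.inv_sub_isBigO i j).mul (hκ i j)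
  refine h1.congr_left fun t => ?_
  simp only [traceWrt, sub_mul, Finset.sum_sub_distrib]
  simp [Matrix.one_apply]

/-- The momentum tensor agrees with its linearisation up to quadratic errors. -/
theorem momentumTensor_sub_isBigO (i j : Fin n) :
    (fun t => momentumTensor (G t) (K t) (x t) i j - momentumField (K t) i j (x t))
      =O[F] fun t => h t * κ t := by
  have h1 : (fun t => (traceWrt (G t) (K t) (x t) - ∑ a, K t (x t) a a) * δ i j)
      =O[F] fun t => h t * κ t := by
    simpa using (H.traceWrt_sub_isBigO hκ).mul (one_apply_isBigO (F := F) i j)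
  have h2 : (fun t => traceWrt (G t) (K t) (x t) * (G t (x t) i j - δ i j))
      =O[F] fun t => h t * κ t :=
    ((H.traceWrt_isBigO hκ).mul (H.sub_isBigO i j)).congr_right fun t => mul_comm _ _
  -- The difference is -[(Tr_g k - ∑ₐ kₐₐ) δ_ij + (Tr_g k)(g_ij - δ_ij)], and each bracketed term
  -- has a factor bounded by `h`.
  refine (h1.add h2).neg_left.congr_left fun t => ?_
  simp only [momentumTensor, momentumField, Matrix.sub_apply, Matrix.smul_apply, smul_eq_mul]
  ring

variable (hK : ∀ᶠ t in F, ∀ i j, DifferentiableAt ℝ (fun y => K t y i j) (x t))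
  (hκ₁ : ∀ k i j, (fun t => pd k (fun y => K t y i j) (x t)) =O[F] κ₁)
  (hκ' : ∀ t, 0 ≤ κ t) (hκ₁' : ∀ t, 0 ≤ κ₁ t)

omit hκ in
include hκ' hκ₁' in
theorem mul_isBigO_momentumError : (fun t => h t * κ₁ t) =O[F] fun t => h t * κ₁ t + d t * κ t :=
  .of_bound 1 <| .of_forall fun t => by
    have h1 := mul_nonneg (H.h_nonneg t) (hκ₁' t)
    have h2 := mul_nonneg (H.d_nonneg t) (hκ' t)
    rw [Real.norm_eq_abs, Real.norm_eq_abs, abs_of_nonneg h1, abs_of_nonneg (by positivity)]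
    linarith

omit hκ in
include hκ' hκ₁' in
theorem mul_isBigO_momentumError' : (fun t => d t * κ t) =O[F] fun t => h t * κ₁ t + d t * κ t :=
  .of_bound 1 <| .of_forall fun t => by
    have h1 := mul_nonneg (H.h_nonneg t) (hκ₁' t)
    have h2 := mul_nonneg (H.d_nonneg t) (hκ' t)
    rw [Real.norm_eq_abs, Real.norm_eq_abs, abs_of_nonneg h2, abs_of_nonneg (by positivity)]
    linarith

include hK hκ₁ hκ' hκ₁'

theorem pd_traceWrt_isBigO (k : Fin n) :
    (fun t => pd k (traceWrt (G t) (K t)) (x t) - ∑ a, pd k (fun y => K t y a a) (x t))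
      =O[F] fun t => h t * κ₁ t + d t * κ t := by
  have h1 : (fun t => ∑ a, ∑ b, (pd k (fun y => (G t y)⁻¹ a b) (x t) * K t (x t) a b +
      ((G t (x t))⁻¹ a b - δ a b) * pd k (fun y => K t y a b) (x t)))
      =O[F] fun t => h t * κ₁ t + d t * κ t := by
    refine .fun_sum fun a _ => .fun_sum fun b _ => .add ?_ ?_
    · exact ((H.pd_inv_isBigO k a b).mul (hκ a b)).trans (H.mul_isBigO_momentumError' hκ' hκ₁')
    · exact ((H.inv_sub_isBigO a b).mul (hκ₁ k a b)).trans (H.mul_isBigO_momentumError hκ' hκ₁')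
  refine h1.congr' ?_ .rfl
  filter_upwards [H.diff, hK, H.det_ne_zero] with t hG hK hdet
  rw [pd_traceWrt hG hK hdet]
  simp only [sub_mul, Finset.sum_add_distrib, Finset.sum_sub_distrib]
  simp [Matrix.one_apply]
  ring

theorem pd_momentumTensor_isBigO (k i j : Fin n) :
    (fun t => pd k (fun y => momentumTensor (G t) (K t) y i j) (x t) -
      pd k (momentumField (K t) i j) (x t)) =O[F] fun t => h t * κ₁ t + d t * κ t := by
  have h1 : (fun t => (pd k (traceWrt (G t) (K t)) (x t) - ∑ a, pd k (fun y => K t y a a) (x t)) *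
      G t (x t) i j) =O[F] fun t => h t * κ₁ t + d t * κ t := by
    simpa using (H.pd_traceWrt_isBigO hκ hK hκ₁ hκ' hκ₁' k).mul (H.apply_isBigO i j)
  have h2 : (fun t => (∑ a, pd k (fun y => K t y a a) (x t)) * (G t (x t) i j - δ i j))
      =O[F] fun t => h t * κ₁ t + d t * κ t := by
    refine .trans ?_ (H.mul_isBigO_momentumError hκ' hκ₁')
    exact ((Asymptotics.IsBigO.fun_sum fun a _ => hκ₁ k a a).mul (H.sub_isBigO i j)).congr_right
      fun t => mul_comm _ _
  have h3 : (fun t => traceWrt (G t) (K t) (x t) * pd k (fun y => G t y i j) (x t))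
      =O[F] fun t => h t * κ₁ t + d t * κ t := by
    refine .trans ?_ (H.mul_isBigO_momentumError' hκ' hκ₁')
    exact ((H.traceWrt_isBigO hκ).mul (H.pd_isBigO k i j)).congr_right fun t => mul_comm _ _
  refine ((h1.add h2).add h3).neg_left.congr' ?_ .rfl
  filter_upwards [H.diff, hK, H.det_ne_zero] with t hG hK hdet
  rw [pd_momentumTensor hG hK hdet, pd_momentumField hK]
  ring

/-- The divergence of the momentum tensor agrees with its linearisation up to quadratic errors. -/
theorem divergence_isBigO (i : Fin n) :
    (fun t => divergence (G t) (momentumTensor (G t) (K t)) i (x t) -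
      flatDiv (momentumField (K t) i) (x t)) =O[F] fun t => h t * κ₁ t + d t * κ t := by
  have hp : ∀ k j, (fun t => pd k (momentumField (K t) i j) (x t)) =O[F] κ₁ := by
    intro k j
    have h0 : (fun t => pd k (fun y => K t y i j) (x t) -
        (∑ a, pd k (fun y => K t y a a) (x t)) * δ i j) =O[F] κ₁ := by
      refine (hκ₁ k i j).sub ?_
      simpa using (Asymptotics.IsBigO.fun_sum (s := Finset.univ) fun a _ => hκ₁ k a a).mul
        (one_apply_isBigO (F := F) i j)
    exact h0.congr' (hK.mono fun t ht => (pd_momentumField ht k i j).symm) .rfl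
  -- The connection terms are products of first derivatives of g with π, so they belong entirely to
  -- the quadratic error.
  have hΓ : ∀ l k j a b, (fun t => christoffel (G t) l k j (x t) *
      momentumTensor (G t) (K t) (x t) a b) =O[F] fun t => h t * κ₁ t + d t * κ t :=
    fun l k j a b => ((H.christoffel_isBigO l k j).mul (H.momentumTensor_isBigO hκ a b)).trans
      (H.mul_isBigO_momentumError' hκ' hκ₁')
  have hcov : ∀ k j, (fun t => covDeriv (G t) (momentumTensor (G t) (K t)) k i j (x t) -
      pd k (momentumField (K t) i j) (x t)) =O[F] fun t => h t * κ₁ t + d t * κ t := by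
    intro k j
    refine (((H.pd_momentumTensor_isBigO hκ hK hκ₁ hκ' hκ₁' k i j).sub
      (.fun_sum (s := Finset.univ) fun l _ => hΓ l k i l j)).sub
      (.fun_sum (s := Finset.univ) fun l _ => hΓ l k j i l)).congr_left ?_
    intro t
    unfold covDeriv
    ring
  have h1 : (fun t => ∑ k, ∑ j, ((G t (x t))⁻¹ k j *
      (covDeriv (G t) (momentumTensor (G t) (K t)) k i j (x t) -
        pd k (momentumField (K t) i j) (x t)) +
      ((G t (x t))⁻¹ k j - δ k j) * pd k (momentumField (K t) i j) (x t)))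
      =O[F] fun t => h t * κ₁ t + d t * κ t := by
    refine .fun_sum fun k _ => .fun_sum fun j _ => .add ?_ ?_
    · simpa using (H.inv_isBigO k j).mul (hcov k j)
    · exact ((H.inv_sub_isBigO k j).mul (hp k j)).trans (H.mul_isBigO_momentumError hκ' hκ₁')
  refine h1.congr_left fun t => ?_
  have e1 : flatDiv (momentumField (K t) i) (x t) =
      ∑ k, ∑ j, δ k j * pd k (momentumField (K t) i j) (x t) := by
    simp [flatDiv, Matrix.one_apply]
  rw [e1]
  unfold divergence
  rw [← Finset.sum_sub_distrib]
  refine Finset.sum_congr rfl fun k _ => ?_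
  rw [← Finset.sum_sub_distrib]
  exact Finset.sum_congr rfl fun j _ => by ring

end SecondFundamentalForm

end NearFlat

end Estimates

/-! ### Iterated partial derivatives -/

section IteratedDerivatives

variable {n : ℕ} {U : Set (Euc n)}

theorem iterPd_zero (v : Fin 0 → Fin n) (f : Euc n → ℝ) : iterPd v f = f := by
  simp [iterPd]

theorem iterPd_succ {a : ℕ} (v : Fin (a + 1) → Fin n) (f : Euc n → ℝ) :
    iterPd v f = pd (v 0) (iterPd (fun i => v i.succ) f) := by
  simp [iterPd, List.ofFn_succ]

theorem iterPd_one (v : Fin 1 → Fin n) (f : Euc n → ℝ) : iterPd v f = pd (v 0) f := by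
  rw [iterPd_succ, iterPd_zero]

theorem iterPd_two (v : Fin 2 → Fin n) (f : Euc n → ℝ) :
    iterPd v f = pd (v 0) (pd (v 1) f) := by
  rw [iterPd_succ, iterPd_one]
  rfl

theorem contDiffOn_iterPd (hU : IsOpen U) {a m : ℕ} (v : Fin a → Fin n) {f : Euc n → ℝ}
    (hf : ContDiffOn ℝ (m + a : ℕ) f U) : ContDiffOn ℝ m (iterPd v f) U := by
  induction a generalizing m with
  | zero => rw [iterPd_zero]; simpa using hf
  | succ a ih =>
    rw [iterPd_succ]
    refine contDiffOn_pd hU ?_ _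
    have : ContDiffOn ℝ ((m + 1) + a : ℕ) f U := by
      rwa [show m + 1 + a = m + (a + 1) by ring]
    exact_mod_cast ih (m := m + 1) _ this

theorem iterPd_add (hU : IsOpen U) {a : ℕ} (v : Fin a → Fin n) {f g : Euc n → ℝ}
    (hf : ContDiffOn ℝ a f U) (hg : ContDiffOn ℝ a g U) {x : Euc n} (hx : x ∈ U) :
    iterPd v (fun y => f y + g y) x = iterPd v f x + iterPd v g x := by
  induction a generalizing x with
  | zero => simp only [iterPd_zero]
  | succ a ih =>
    have hle : ((a : ℕ∞ω)) ≤ ((a + 1 : ℕ) : ℕ∞ω) := by exact_mod_cast Nat.le_succ a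
    have hd : ∀ {u : Euc n → ℝ}, ContDiffOn ℝ (a + 1 : ℕ) u U →
        DifferentiableAt ℝ (iterPd (fun i : Fin a => v i.succ) u) x := fun {u} hu =>
      ((contDiffOn_iterPd hU (m := 1) _ (by rwa [add_comm])).contDiffAt
        (hU.mem_nhds hx)).differentiableAt (by simp)
    simp only [iterPd_succ]
    rw [← pd_add (hd hf) (hd hg)]
    unfold pd
    rw [Filter.EventuallyEq.fderiv_eq]
    filter_upwards [hU.mem_nhds hx] with y hy
    exact ih _ (hf.of_le hle) (hg.of_le hle) hy

end IteratedDerivatives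

/-! ### Uniform pointwise bounds for vacuum data -/

section DerivSize

variable {n : ℕ}

/-- The sum of the absolute values of all derivatives of order `a` of the components `f`. -/
def derivSize (a : ℕ) (f : Fin n → Fin n → Euc n → ℝ) (x : Euc n) : ℝ :=
  ∑ z : Fin n × Fin n × (Fin a → Fin n), |iterPd z.2.2 (f z.1 z.2.1) x|

theorem derivSize_nonneg (a : ℕ) (f : Fin n → Fin n → Euc n → ℝ) (x : Euc n) :
    0 ≤ derivSize a f x :=
  Finset.sum_nonneg fun _ _ => abs_nonneg _

theorem abs_iterPd_le_derivSize {a : ℕ} (f : Fin n → Fin n → Euc n → ℝ) (x : Euc n)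
    (i j : Fin n) (v : Fin a → Fin n) : |iterPd v (f i j) x| ≤ derivSize a f x :=
  Finset.single_le_sum (f := fun z : Fin n × Fin n × (Fin a → Fin n) =>
    |iterPd z.2.2 (f z.1 z.2.1) x|) (fun _ _ => abs_nonneg _) (Finset.mem_univ (i, j, v))

theorem abs_le_derivSize_zero (f : Fin n → Fin n → Euc n → ℝ) (x : Euc n)
    (i j : Fin n) : |f i j x| ≤ derivSize 0 f x := by
  simpa only [iterPd_zero] using abs_iterPd_le_derivSize f x i j ![]

theorem abs_pd_le_derivSize_one (f : Fin n → Fin n → Euc n → ℝ) (x : Euc n)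
    (k i j : Fin n) : |pd k (f i j) x| ≤ derivSize 1 f x := by
  have h := abs_iterPd_le_derivSize (a := 1) f x i j fun _ => k
  rwa [iterPd_one] at h

theorem abs_pd_pd_le_derivSize_two (f : Fin n → Fin n → Euc n → ℝ) (x : Euc n)
    (k l i j : Fin n) : |pd k (pd l (f i j)) x| ≤ derivSize 2 f x := by
  have h := abs_iterPd_le_derivSize (a := 2) f x i j ![k, l]
  rwa [iterPd_two] at h

/-- The components of `g - δ`. -/
def deviation (G : Components n) (i j : Fin n) (x : Euc n) : ℝ :=
  G x i j - (1 : Matrix (Fin n) (Fin n) ℝ) i j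

/-- The components of a `(0,2)`-tensor as functions. -/
def entries (K : Components n) (i j : Fin n) (x : Euc n) : ℝ := K x i j

theorem pd_deviation (G : Components n) (k i j : Fin n) :
    pd k (deviation G i j) = pd k fun y => G y i j :=
  pd_sub_const k _ _

/-- Components `(G, K)` of vacuum initial data on the exterior of a ball. -/
structure IsEndVacuum (R : ℝ) (G K : Components n) : Prop where
  contDiffOn_g : ∀ i j, ContDiffOn ℝ 2 (fun y => G y i j) {x | R < ‖x‖}
  contDiffOn_k : ∀ i j, ContDiffOn ℝ 1 (fun y => K y i j) {x | R < ‖x‖}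
  constraints : ∀ x, R < ‖x‖ → VacuumConstraintsAt G K x

variable {ι : Type*} {R : ℝ} {G K : ι → Components n}

theorem isBigO_of_abs_le {β : Type*} {F : Filter β} {f g : β → ℝ} (h : ∀ t, |f t| ≤ g t) :
    f =O[F] g :=
  .of_bound 1 <| .of_forall fun t => by
    rw [one_mul]
    exact (h t).trans (le_abs_self _)

/-- The base filter is left free: a principal filter on pairs (datum, point) gives constants uniform
in the family, and the filter at infinity gives decay of a single datum. -/
theorem nearFlat_of_derivSize {β : Type*} {F : Filter β} {G : β → Components n} {x : β → Euc n}
    (hG : ∀ᶠ t in F, ∀ i j, DifferentiableAt ℝ (fun y => G t y i j) (x t))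
    (hs : ∀ᶠ t in F, derivSize 0 (deviation (G t)) (x t) ≤ 1 / (2 * n)) :
    NearFlat F G x (fun t => derivSize 0 (deviation (G t)) (x t))
      (fun t => derivSize 1 (deviation (G t)) (x t)) where
  diff := hG
  near := hs.mono fun t ht => ⟨fun i j => abs_le_derivSize_zero (deviation (G t)) (x t) i j, ht⟩
  h_nonneg _ := derivSize_nonneg _ _ _
  d_nonneg _ := derivSize_nonneg _ _ _
  pd_isBigO k i j := isBigO_of_abs_le fun t => by
    rw [← pd_deviation]
    exact abs_pd_le_derivSize_one _ _ _ _ _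

/-- Where `h` is bounded below by a positive constant, a linear bound is also a quadratic one. This
handles the points at which the metric is far from flat. -/
theorem isBigO_mul_of_lt {β : Type*} {S : Set β} {f h g : β → ℝ} {c : ℝ} (hc : 0 < c)
    (hf : f =O[𝓟 S] g) (hh : ∀ t ∈ S, c < h t) : f =O[𝓟 S] fun t => h t * g t := by
  refine hf.trans (.of_bound c⁻¹ ?_)
  rw [eventually_principal]
  intro t ht
  have h1 := hh t ht
  rw [norm_mul, Real.norm_eq_abs (h t), abs_of_pos (hc.trans h1), ← mul_assoc]
  refine le_mul_of_one_le_left (norm_nonneg _) ?_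
  rw [inv_mul_eq_div, one_le_div hc]
  exact h1.le

theorem isBigO_of_le {β : Type*} {F : Filter β} {f g : β → ℝ} (h0 : ∀ t, 0 ≤ f t)
    (h : ∀ t, f t ≤ g t) : f =O[F] g :=
  isBigO_of_abs_le fun t => by rw [abs_of_nonneg (h0 t)]; exact h t

theorem principal_exterior_eq_sup (R c : ℝ) (h : ι × Euc n → ℝ) :
    𝓟 {t : ι × Euc n | R < ‖t.2‖} =
      𝓟 {t : ι × Euc n | R < ‖t.2‖ ∧ h t ≤ c} ⊔ 𝓟 {t : ι × Euc n | R < ‖t.2‖ ∧ c < h t} := by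
  rw [sup_principal]
  congr 1
  ext t
  have := le_or_gt (h t) c
  simp only [mem_union, mem_ofPred_eq]
  tauto

/-- Uniform bound for the linearised scalar curvature of vacuum data; where the metric is not near
the flat one, the bound holds without using the constraints. -/
theorem flatDiv_energyField_isBigO (hn : 0 < n) (H : ∀ a, IsEndVacuum R (G a) (K a)) :
    (fun t : ι × Euc n => flatDiv (energyField (G t.1)) t.2) =O[𝓟 {t | R < ‖t.2‖}]
      fun t => derivSize 0 (deviation (G t.1)) t.2 * derivSize 2 (deviation (G t.1)) t.2 +
        derivSize 1 (deviation (G t.1)) t.2 ^ 2 + derivSize 0 (entries (K t.1)) t.2 ^ 2 := by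
  have hc : (0 : ℝ) < 1 / (2 * n) := by positivity
  have hsm : ∀ t : ι × Euc n, R < ‖t.2‖ → ∀ i j,
      ContDiffAt ℝ 2 (fun y => G t.1 y i j) t.2 := fun t ht i j =>
    ((H t.1).contDiffOn_g i j).contDiffAt ((isOpen_exterior R).mem_nhds ht)
  have hpd2 : ∀ (F : Filter (ι × Euc n)) k l i j,
      (fun t : ι × Euc n => pd k (pd l fun y => G t.1 y i j) t.2) =O[F]
        fun t => derivSize 2 (deviation (G t.1)) t.2 := fun F k l i j =>
    isBigO_of_abs_le fun t => by
      rw [← pd_deviation]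
      exact abs_pd_pd_le_derivSize_two _ _ _ _ _ _
  have n0 := fun t : ι × Euc n => derivSize_nonneg 0 (deviation (G t.1)) t.2
  have n2 := fun t : ι × Euc n => derivSize_nonneg 2 (deviation (G t.1)) t.2
  have n02 := fun t => mul_nonneg (n0 t) (n2 t)
  -- The exterior is split according to whether g-δ is below the threshold required for the bounds
  -- on g⁻¹. The weighted norms do not make the second region empty.
  rw [principal_exterior_eq_sup R (1 / (2 * n)) fun t => derivSize 0 (deviation (G t.1)) t.2,
    Asymptotics.isBigO_sup]
  constructor
  · set F := 𝓟 {t : ι × Euc n | R < ‖t.2‖ ∧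
      derivSize 0 (deviation (G t.1)) t.2 ≤ 1 / (2 * n)} with hF
    have hFm : ∀ᶠ t in F, R < ‖t.2‖ ∧ derivSize 0 (deviation (G t.1)) t.2 ≤ 1 / (2 * n) :=
      mem_principal_self _
    have hNF : NearFlat F (fun t => G t.1) (fun t => t.2) _ _ :=
      nearFlat_of_derivSize
        (hFm.mono fun t ht i j => (hsm t ht.1 i j).differentiableAt (by simp))
        (hFm.mono fun t ht => ht.2)
    have hκ : ∀ i j, (fun t : ι × Euc n => K t.1 t.2 i j) =O[F]
        fun t => derivSize 0 (entries (K t.1)) t.2 := fun i j =>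
      isBigO_of_abs_le fun t => abs_le_derivSize_zero (entries (K t.1)) t.2 i j
    have h1 := hNF.scalarCurvature_isBigO (hFm.mono fun t ht i j => hsm t ht.1 i j)
      (hpd2 F) n2
    have h2 := (hNF.normSqWrt_isBigO hκ).sub ((hNF.traceWrt_isBigO hκ).pow 2)
    have h1' := h1.trans (k := fun t : ι × Euc n =>
      derivSize 0 (deviation (G t.1)) t.2 * derivSize 2 (deviation (G t.1)) t.2 +
        derivSize 1 (deviation (G t.1)) t.2 ^ 2 + derivSize 0 (entries (K t.1)) t.2 ^ 2)
      (isBigO_of_le (fun t => add_nonneg (n02 t) (sq_nonneg _))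
        fun t => le_add_of_nonneg_right (sq_nonneg _))
    have h2' := h2.trans (k := fun t : ι × Euc n =>
      derivSize 0 (deviation (G t.1)) t.2 * derivSize 2 (deviation (G t.1)) t.2 +
        derivSize 1 (deviation (G t.1)) t.2 ^ 2 + derivSize 0 (entries (K t.1)) t.2 ^ 2)
      (isBigO_of_le (fun t => sq_nonneg _)
        fun t => le_add_of_nonneg_left (add_nonneg (n02 t) (sq_nonneg _)))
    -- By the Hamiltonian constraint div V = (‖k‖² - (Tr k)²) - (R_g - div V), and both brackets are
    -- quadratic.
    refine (h2'.sub h1').congr' ?_ .rfl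
    filter_upwards [hFm] with t ht
    have := ((H t.1).constraints t.2 ht.1).1
    linarith
  · have h1 : (fun t : ι × Euc n => flatDiv (energyField (G t.1)) t.2)
        =O[𝓟 {t | R < ‖t.2‖ ∧ 1 / (2 * n) < derivSize 0 (deviation (G t.1)) t.2}]
        fun t => derivSize 2 (deviation (G t.1)) t.2 := by
      have h0 : (fun t : ι × Euc n => ∑ j, ∑ i, (pd j (pd i fun y => G t.1 y i j) t.2 -
          pd j (pd j fun y => G t.1 y i i) t.2))
          =O[𝓟 {t | R < ‖t.2‖ ∧ 1 / (2 * n) < derivSize 0 (deviation (G t.1)) t.2}]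
          fun t => derivSize 2 (deviation (G t.1)) t.2 :=
        .fun_sum fun j _ => .fun_sum fun i _ => (hpd2 _ j i i j).sub (hpd2 _ j j i i)
      refine h0.congr' ?_ .rfl
      filter_upwards [mem_principal_self _] with t ht
      exact (flatDiv_energyField (hsm t ht.1)).symm
    -- Here div V is estimated by the second derivatives alone, and the missing factor |g-δ| exceeds
    -- 1/(2n).
    refine (isBigO_mul_of_lt hc h1 fun t ht => ht.2).trans (isBigO_of_le n02 fun t => ?_)
    have := sq_nonneg (derivSize 1 (deviation (G t.1)) t.2)
    have := sq_nonneg (derivSize 0 (entries (K t.1)) t.2)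
    linarith

/-- Uniform bound for the linearised divergence of the momentum tensor of vacuum data. -/
theorem flatDiv_momentumField_isBigO (hn : 0 < n) (H : ∀ a, IsEndVacuum R (G a) (K a))
    (i : Fin n) :
    (fun t : ι × Euc n => flatDiv (momentumField (K t.1) i) t.2) =O[𝓟 {t | R < ‖t.2‖}]
      fun t => derivSize 0 (deviation (G t.1)) t.2 * derivSize 1 (entries (K t.1)) t.2 +
        derivSize 1 (deviation (G t.1)) t.2 * derivSize 0 (entries (K t.1)) t.2 := by
  have hc : (0 : ℝ) < 1 / (2 * n) := by positivity
  have hsm : ∀ t : ι × Euc n, R < ‖t.2‖ → ∀ i j,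
      DifferentiableAt ℝ (fun y => G t.1 y i j) t.2 := fun t ht i j =>
    (((H t.1).contDiffOn_g i j).contDiffAt ((isOpen_exterior R).mem_nhds ht)).differentiableAt
      (by simp)
  have hsm' : ∀ t : ι × Euc n, R < ‖t.2‖ → ∀ i j,
      DifferentiableAt ℝ (fun y => K t.1 y i j) t.2 := fun t ht i j =>
    (((H t.1).contDiffOn_k i j).contDiffAt ((isOpen_exterior R).mem_nhds ht)).differentiableAt
      (by simp)
  have hpd : ∀ (F : Filter (ι × Euc n)) k i j,
      (fun t : ι × Euc n => pd k (fun y => K t.1 y i j) t.2) =O[F]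
        fun t => derivSize 1 (entries (K t.1)) t.2 := fun F k i j =>
    isBigO_of_abs_le fun t => abs_pd_le_derivSize_one (entries (K t.1)) t.2 k i j
  have n0 := fun t : ι × Euc n => derivSize_nonneg 0 (deviation (G t.1)) t.2
  have n1 := fun t : ι × Euc n => derivSize_nonneg 1 (deviation (G t.1)) t.2
  have m0 := fun t : ι × Euc n => derivSize_nonneg 0 (entries (K t.1)) t.2
  have m1 := fun t : ι × Euc n => derivSize_nonneg 1 (entries (K t.1)) t.2
  -- The same dichotomy as for the energy: the momentum constraint serves near the flat metric, and
  -- the bare bound by ∂k elsewhere.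
  rw [principal_exterior_eq_sup R (1 / (2 * n)) fun t => derivSize 0 (deviation (G t.1)) t.2,
    Asymptotics.isBigO_sup]
  constructor
  · set F := 𝓟 {t : ι × Euc n | R < ‖t.2‖ ∧
      derivSize 0 (deviation (G t.1)) t.2 ≤ 1 / (2 * n)} with hF
    have hFm : ∀ᶠ t in F, R < ‖t.2‖ ∧ derivSize 0 (deviation (G t.1)) t.2 ≤ 1 / (2 * n) :=
      mem_principal_self _
    have hNF : NearFlat F (fun t => G t.1) (fun t => t.2) _ _ :=
      nearFlat_of_derivSize (hFm.mono fun t ht i j => hsm t ht.1 i j)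
        (hFm.mono fun t ht => ht.2)
    have hκ : ∀ i j, (fun t : ι × Euc n => K t.1 t.2 i j) =O[F]
        fun t => derivSize 0 (entries (K t.1)) t.2 := fun i j =>
      isBigO_of_abs_le fun t => abs_le_derivSize_zero (entries (K t.1)) t.2 i j
    have h1 := hNF.divergence_isBigO hκ (hFm.mono fun t ht i j => hsm' t ht.1 i j)
      (hpd F) m0 m1 i
    refine h1.neg_left.congr' ?_ .rfl
    filter_upwards [hFm] with t ht
    rw [((H t.1).constraints t.2 ht.1).2 i]
    ring
  · have h1 : (fun t : ι × Euc n => flatDiv (momentumField (K t.1) i) t.2)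
        =O[𝓟 {t | R < ‖t.2‖ ∧ 1 / (2 * n) < derivSize 0 (deviation (G t.1)) t.2}]
        fun t => derivSize 1 (entries (K t.1)) t.2 := by
      have h0 : (fun t : ι × Euc n => ∑ j, (pd j (fun y => K t.1 y i j) t.2 -
          (∑ a, pd j (fun y => K t.1 y a a) t.2) * (1 : Matrix (Fin n) (Fin n) ℝ) i j))
          =O[𝓟 {t | R < ‖t.2‖ ∧ 1 / (2 * n) < derivSize 0 (deviation (G t.1)) t.2}]
          fun t => derivSize 1 (entries (K t.1)) t.2 := by
        refine .fun_sum fun j _ => (hpd _ j i j).sub ?_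
        simpa using (Asymptotics.IsBigO.fun_sum (s := Finset.univ) fun a _ => hpd _ j a a).mul
          (one_apply_isBigO i j)
      refine h0.congr' ?_ .rfl
      filter_upwards [mem_principal_self _] with t ht
      exact Finset.sum_congr rfl fun j _ => (pd_momentumField (hsm' t ht.1) j i j).symm
    refine (isBigO_mul_of_lt hc h1 fun t ht => ht.2).trans
      (isBigO_of_le (fun t => mul_nonneg (n0 t) (m1 t)) fun t => ?_)
    exact le_add_of_nonneg_right (mul_nonneg (n1 t) (m0 t))

end DerivSize

/-! ### Existence of the charges under pointwise decay -/

section Decay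

variable {n : ℕ} {R : ℝ}

theorem eventually_cobounded_lt_norm (R : ℝ) :
    ∀ᶠ x in Bornology.cobounded (Euc n), R < ‖x‖ :=
  tendsto_norm_cobounded_atTop.eventually (eventually_gt_atTop R)

theorem exists_of_eventually_cobounded {P : Euc n → Prop}
    (h : ∀ᶠ x in Bornology.cobounded (Euc n), P x) : ∃ r, ∀ x, r ≤ ‖x‖ → P x := by
  obtain ⟨r, -, hr⟩ := hasBasis_cobounded_norm.eventually_iff.1 h
  exact ⟨r, fun x hx => hr hx⟩

theorem rpow_norm_mul_isBigO {a b c : ℝ} (h : a + b = c) :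
    (fun x : Euc n => ‖x‖ ^ a * ‖x‖ ^ b) =O[Bornology.cobounded (Euc n)] fun x => ‖x‖ ^ c := by
  refine Filter.EventuallyEq.isBigO ?_
  filter_upwards [eventually_cobounded_lt_norm 0] with x hx
  rw [← Real.rpow_add hx, h]

theorem isBigO_mul_rpow {f g : Euc n → ℝ} {a b c : ℝ}
    (hf : f =O[Bornology.cobounded (Euc n)] fun x => ‖x‖ ^ a)
    (hg : g =O[Bornology.cobounded (Euc n)] fun x => ‖x‖ ^ b) (h : a + b = c) :
    (fun x => f x * g x) =O[Bornology.cobounded (Euc n)] fun x => ‖x‖ ^ c :=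
  (hf.mul hg).trans (rpow_norm_mul_isBigO h)

theorem derivSize_isBigO {m a : ℕ} (ha : a ≤ m) {q : ℝ} {f : Fin n → Fin n → Euc n → ℝ}
    (hf : ∀ i j, DecaysToOrder m q (f i j)) :
    derivSize a f =O[Bornology.cobounded (Euc n)] fun x => ‖x‖ ^ (-q - a) :=
  .fun_sum fun z _ => (hf z.1 z.2.1 a ha z.2.2).norm_left

theorem exists_integrableOn_of_isBigO {f : Euc n → ℝ} {r : ℝ} (hr : n < r)
    (hf : ContinuousOn f {x | R < ‖x‖})
    (hO : f =O[Bornology.cobounded (Euc n)] fun x => ‖x‖ ^ (-r)) :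
    ∃ a, R < a ∧ IntegrableOn f {x | a < ‖x‖} := by
  obtain ⟨C, hC⟩ := hO.bound
  obtain ⟨b, hb⟩ := exists_of_eventually_cobounded hC
  have hr0 : 0 < r := (Nat.cast_nonneg n).trans_lt hr
  -- Besides lying beyond `R` and `b`, the radius is at least 1, so that 1 + |x| ≤ 2|x| and the
  -- integrable function (1+|x|)^{-r} dominates up to the factor 2^r.
  refine ⟨max (max (R + 1) b) 1, ?_, ?_⟩
  · exact lt_of_lt_of_le (by linarith) ((le_max_left _ _).trans (le_max_left _ _))
  · have hi : Integrable (fun x : Euc n => |C| * 2 ^ r * (1 + ‖x‖) ^ (-r)) :=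
      (integrable_one_add_norm (by simpa using hr)).const_mul _
    refine hi.integrableOn.mono' ?_ ?_
    · refine (hf.mono fun x hx => ?_).aestronglyMeasurable (measurableSet_exterior _)
      have h1 : max (max (R + 1) b) 1 < ‖x‖ := hx
      have h2 : R + 1 ≤ max (max (R + 1) b) 1 := (le_max_left _ _).trans (le_max_left _ _)
      show R < ‖x‖
      linarith
    · refine (ae_restrict_iff' (measurableSet_exterior _)).2 (.of_forall fun x hx => ?_)
      have h1 : max (max (R + 1) b) 1 < ‖x‖ := hx
      have h2 : b ≤ ‖x‖ := ((le_max_right _ _).trans (le_max_left _ _)).trans h1.le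
      have h3 : 1 < ‖x‖ := (le_max_right _ _).trans_lt h1
      have h4 := hb x h2
      have h5 : (1 + ‖x‖) ^ r ≤ 2 ^ r * ‖x‖ ^ r := by
        rw [← Real.mul_rpow (by norm_num) (norm_nonneg _)]
        exact Real.rpow_le_rpow (by positivity) (by linarith) hr0.le
      have h6 : ‖x‖ ^ (-r) ≤ 2 ^ r * (1 + ‖x‖) ^ (-r) := by
        rw [Real.rpow_neg (norm_nonneg _), Real.rpow_neg (by positivity), ← div_eq_mul_inv,
          inv_eq_one_div, div_le_div_iff₀ (by positivity) (by positivity)]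
        linarith
      calc ‖f x‖ ≤ C * ‖‖x‖ ^ (-r)‖ := h4
        _ ≤ |C| * ‖‖x‖ ^ (-r)‖ := by gcongr; exact le_abs_self C
        _ = |C| * ‖x‖ ^ (-r) := by
          rw [Real.norm_eq_abs, abs_of_nonneg (Real.rpow_nonneg (norm_nonneg _) _)]
        _ ≤ |C| * (2 ^ r * (1 + ‖x‖) ^ (-r)) := by gcongr
        _ = _ := by ring

/-- The area grows like r^{n-1}, more slowly than the integrand decays. -/
theorem tendsto_sphereIntegral_zero (hn : 0 < n) {f : Euc n → ℝ} {r₀ : ℝ} (hr : (n : ℝ) - 1 < r₀)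
    (hO : f =O[Bornology.cobounded (Euc n)] fun x => ‖x‖ ^ (-r₀)) :
    Tendsto (fun r => sphereIntegral r f) atTop (𝓝 0) := by
  obtain ⟨C, hC⟩ := hO.bound
  obtain ⟨b, hb⟩ := exists_of_eventually_cobounded hC
  have hlim : Tendsto (fun r : ℝ => C * sphereArea n * r ^ (-(r₀ - (n - 1)))) atTop (𝓝 0) := by
    simpa using (tendsto_rpow_neg_atTop (sub_pos.2 hr)).const_mul (C * sphereArea n)
  refine squeeze_zero_norm' ?_ hlim
  filter_upwards [eventually_gt_atTop 0, eventually_ge_atTop b] with r h0 hrb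
  have h1 : ‖∫ y : Metric.sphere (0 : Euc n) 1, f (r • (y : Euc n))
      ∂(volume : Measure (Euc n)).toSphere‖ ≤ C * r ^ (-r₀) * sphereArea n := by
    refine norm_integral_le_of_norm_le_const (.of_forall fun y => ?_)
    have hy : ‖r • (y : Euc n)‖ = r := by simp [norm_smul, abs_of_pos h0]
    have h2 := hb (r • (y : Euc n)) (by rw [hy]; exact hrb)
    rwa [hy, Real.norm_eq_abs (r ^ _), abs_of_nonneg (Real.rpow_nonneg h0.le _)] at h2
  have h3 : r ^ (n - 1) * r ^ (-r₀) = r ^ (-(r₀ - (n - 1))) := by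
    rw [← Real.rpow_natCast r (n - 1), ← Real.rpow_add h0, Nat.cast_sub hn]
    congr 1
    push_cast
    ring
  unfold sphereIntegral
  rw [norm_mul, Real.norm_eq_abs (r ^ _), abs_of_nonneg (by positivity)]
  calc r ^ (n - 1) * _ ≤ r ^ (n - 1) * (C * r ^ (-r₀) * sphereArea n) := by gcongr
    _ = C * sphereArea n * (r ^ (n - 1) * r ^ (-r₀)) := by ring
    _ = _ := by rw [h3]

theorem integrable_sphere {f : Euc n → ℝ} {r : ℝ} (hr : 0 ≤ r)
    (hf : ∀ x, ‖x‖ = r → ContinuousAt f x) :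
    Integrable (fun y : Metric.sphere (0 : Euc n) 1 => f (r • (y : Euc n)))
      (volume : Measure (Euc n)).toSphere := by
  have hc : Continuous fun y : Metric.sphere (0 : Euc n) 1 => f (r • (y : Euc n)) := by
    rw [continuous_iff_continuousAt]
    intro y
    refine ContinuousAt.comp (f := fun y : Metric.sphere (0 : Euc n) 1 => r • (y : Euc n))
      (hf _ (by simp [norm_smul, abs_of_nonneg hr])) ?_
    exact (by fun_prop : Continuous fun y : Metric.sphere (0 : Euc n) 1 =>
      r • (y : Euc n)).continuousAt
  exact hc.integrable_of_hasCompactSupport (HasCompactSupport.of_compactSpace _)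

theorem sphereIntegral_sub {f g : Euc n → ℝ} {r : ℝ} (hr : 0 ≤ r)
    (hf : ∀ x, ‖x‖ = r → ContinuousAt f x) (hg : ∀ x, ‖x‖ = r → ContinuousAt g x) :
    sphereIntegral r (fun x => f x - g x) = sphereIntegral r f - sphereIntegral r g := by
  unfold sphereIntegral
  rw [integral_sub (integrable_sphere hr hf) (integrable_sphere hr hg)]
  ring

variable {G K : Components n}

theorem contDiffOn_energyField (H : IsEndVacuum R G K) (j : Fin n) :
    ContDiffOn ℝ 1 (energyField G j) {x | R < ‖x‖} := by
  have h2 : ∀ i j, ContDiffOn ℝ (1 + 1 : ℕ) (fun y => G y i j) {x | R < ‖x‖} := H.contDiffOn_g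
  refine ContDiffOn.sum fun i _ => ?_
  exact (contDiffOn_pd (m := 1) (isOpen_exterior R) (h2 i j) i).sub
    (contDiffOn_pd (m := 1) (isOpen_exterior R) (h2 i i) j)

theorem contDiffOn_momentumField (H : IsEndVacuum R G K) (i j : Fin n) :
    ContDiffOn ℝ 1 (momentumField K i j) {x | R < ‖x‖} :=
  (H.contDiffOn_k i j).sub ((ContDiffOn.sum fun a _ => H.contDiffOn_k a a).mul contDiffOn_const)

/-- Specialises the uniform bounds to a family with one member and to points going to infinity. -/
theorem tendsto_unit_exterior (R : ℝ) : Tendsto (fun x : Euc n => ((), x))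
    (Bornology.cobounded (Euc n)) (𝓟 {t : Unit × Euc n | R < ‖t.2‖}) :=
  tendsto_principal.2 (eventually_cobounded_lt_norm R)

variable {q : ℝ}

theorem exists_tendsto_energy_flux (hn : 0 < n) (hR : 0 ≤ R) (H : IsEndVacuum R G K)
    (hq : ((n : ℝ) - 2) / 2 < q) (hg : ∀ i j, DecaysToOrder 2 q (deviation G i j))
    (hk : ∀ i j, DecaysToOrder 1 (q + 1) (entries K i j)) :
    ∃ E, Tendsto (fun r => sphereIntegral r (radialPart (energyField G))) atTop (𝓝 E) := by
  have h1 := (flatDiv_energyField_isBigO hn fun _ : Unit => H).comp_tendsto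
    (tendsto_unit_exterior R)
  have hO : flatDiv (energyField G) =O[Bornology.cobounded (Euc n)]
      fun x => ‖x‖ ^ (-(2 * q + 2)) := by
    refine h1.trans (.add (.add ?_ ?_) ?_)
    · exact isBigO_mul_rpow (derivSize_isBigO (by norm_num) hg)
        (derivSize_isBigO (by norm_num) hg) (by push_cast; ring)
    · simp only [sq]
      exact isBigO_mul_rpow (derivSize_isBigO (by norm_num) hg)
        (derivSize_isBigO (by norm_num) hg) (by push_cast; ring)
    · simp only [sq]
      exact isBigO_mul_rpow (derivSize_isBigO (by norm_num) hk)
        (derivSize_isBigO (by norm_num) hk) (by push_cast; ring)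
  -- The condition q > (n-2)/2 is exactly 2q+2 > n.
  obtain ⟨a, ha, hi⟩ := exists_integrableOn_of_isBigO (by linarith)
    (continuousOn_flatDiv (contDiffOn_energyField H)) hO
  exact ⟨_, tendsto_flux hn hR (contDiffOn_energyField H) ha hi⟩

theorem exists_tendsto_momentum_flux (hn : 0 < n) (hR : 0 ≤ R) (H : IsEndVacuum R G K)
    (hq : ((n : ℝ) - 2) / 2 < q) (hg : ∀ i j, DecaysToOrder 2 q (deviation G i j))
    (hk : ∀ i j, DecaysToOrder 1 (q + 1) (entries K i j)) (i : Fin n) :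
    ∃ P, Tendsto (fun r => sphereIntegral r (radialPart (momentumField K i))) atTop (𝓝 P) := by
  have h1 := (flatDiv_momentumField_isBigO hn (fun _ : Unit => H) i).comp_tendsto
    (tendsto_unit_exterior R)
  have hO : flatDiv (momentumField K i) =O[Bornology.cobounded (Euc n)]
      fun x => ‖x‖ ^ (-(2 * q + 2)) := by
    refine h1.trans (.add ?_ ?_)
    · exact isBigO_mul_rpow (derivSize_isBigO (by norm_num) hg)
        (derivSize_isBigO (by norm_num) hk) (by push_cast; ring)
    · exact isBigO_mul_rpow (derivSize_isBigO (by norm_num) hg)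
        (derivSize_isBigO (by norm_num) hk) (by push_cast; ring)
  obtain ⟨a, ha, hi⟩ := exists_integrableOn_of_isBigO (by linarith)
    (continuousOn_flatDiv (contDiffOn_momentumField H i)) hO
  exact ⟨_, tendsto_flux hn hR (contDiffOn_momentumField H i) ha hi⟩

/-- The fluxes of the momentum tensor and of its linearisation have the same limit. -/
theorem tendsto_momentumTensor_flux (hn : 3 ≤ n) (hR : 0 ≤ R) (H : IsEndVacuum R G K)
    (hq : ((n : ℝ) - 2) / 2 < q) (hg : ∀ i j, DecaysToOrder 2 q (deviation G i j))
    (hk : ∀ i j, DecaysToOrder 1 (q + 1) (entries K i j)) {i : Fin n} {P : ℝ}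
    (hP : Tendsto (fun r => sphereIntegral r (radialPart (momentumField K i))) atTop (𝓝 P)) :
    Tendsto (fun r => sphereIntegral r fun x => ∑ j, momentumTensor G K x i j * (x j / ‖x‖))
      atTop (𝓝 P) := by
  have hn0 : 0 < n := by omega
  have hn3 : (3 : ℝ) ≤ n := by exact_mod_cast hn
  -- This is where n ≥ 3 enters: it makes q positive, so that g tends to δ and the near-flat
  -- estimates apply at infinity.
  have hq0 : 0 < q := by linarith
  have hext := eventually_cobounded_lt_norm (n := n) R
  have hGd : ∀ x, R < ‖x‖ → ∀ i j, DifferentiableAt ℝ (fun y => G y i j) x := fun x hx i j =>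
    ((H.contDiffOn_g i j).contDiffAt ((isOpen_exterior R).mem_nhds hx)).differentiableAt (by simp)
  have hKd : ∀ x, R < ‖x‖ → ∀ i j, DifferentiableAt ℝ (fun y => K y i j) x := fun x hx i j =>
    ((H.contDiffOn_k i j).contDiffAt ((isOpen_exterior R).mem_nhds hx)).differentiableAt (by simp)
  have hsize := derivSize_isBigO (a := 0) (by norm_num) hg
  have hsmall : ∀ᶠ x in Bornology.cobounded (Euc n),
      derivSize 0 (deviation G) x ≤ 1 / (2 * n) := by
    have h0 : Tendsto (fun x : Euc n => ‖x‖ ^ (-q - (0 : ℕ))) (Bornology.cobounded (Euc n))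
        (𝓝 0) := by
      simpa [Function.comp_def] using (tendsto_rpow_neg_atTop hq0).comp (tendsto_norm_cobounded_atTop (E := Euc n))
    exact (hsize.trans_tendsto h0).eventually_le_const (by positivity)
  have hNF : NearFlat (Bornology.cobounded (Euc n)) (fun _ => G) (fun x => x) _ _ :=
    nearFlat_of_derivSize (hext.mono fun x hx => hGd x hx) hsmall
  have hκ : ∀ i j, (fun x => K x i j) =O[Bornology.cobounded (Euc n)]
      fun x => ‖x‖ ^ (-(q + 1) - (0 : ℕ)) := fun i j => by
    have h := hk i j 0 (by norm_num) ![]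
    rw [iterPd_zero] at h
    exact h
  have hdiff : ∀ j, (fun x => momentumTensor G K x i j - momentumField K i j x)
      =O[Bornology.cobounded (Euc n)] fun x => ‖x‖ ^ (-(2 * q + 1)) := fun j =>
    (hNF.momentumTensor_sub_isBigO hκ i j).trans <|
      isBigO_mul_rpow hsize (Asymptotics.isBigO_refl _ _) (by push_cast; ring)
  have hzero : Tendsto (fun r => sphereIntegral r fun x =>
      ∑ j, momentumTensor G K x i j * (x j / ‖x‖) - radialPart (momentumField K i) x)
      atTop (𝓝 0) := by
    -- The difference is a product of g-δ and k, of order |x|^{-q} |x|^{-q-1}, and 2q+1 > n-1.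
    refine tendsto_sphereIntegral_zero hn0 (r₀ := 2 * q + 1) (by linarith) ?_
    have h1 : (fun x : Euc n => ∑ j, (momentumTensor G K x i j - momentumField K i j x) *
        (x j / ‖x‖)) =O[Bornology.cobounded (Euc n)] fun x => ‖x‖ ^ (-(2 * q + 1)) := by
      refine .fun_sum fun j _ => ?_
      have h2 : (fun x : Euc n => x j / ‖x‖) =O[Bornology.cobounded (Euc n)]
          fun _ => (1 : ℝ) := by
        refine .of_bound 1 (.of_forall fun x => ?_)
        rw [norm_div, norm_norm, norm_one, one_mul]
        exact div_le_one_of_le₀ (PiLp.norm_apply_le x j) (norm_nonneg _)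
      simpa using (hdiff j).mul h2
    refine h1.congr_left fun x => ?_
    simp only [radialPart, sub_mul, Finset.sum_sub_distrib]
  -- Splitting the integral requires continuity of π on the sphere, hence an invertible matrix of
  -- metric components; this is known for large radii only.
  obtain ⟨b, hb⟩ := exists_of_eventually_cobounded (hext.and hNF.det_ne_zero)
  rw [← add_zero P]
  refine (hP.add hzero).congr' ?_
  filter_upwards [eventually_gt_atTop R, eventually_ge_atTop b] with r hrR hrb
  have hr0 : 0 < r := hR.trans_lt hrR
  rw [sphereIntegral_sub hr0.le]
  · ring
  · intro x hx
    have hxR : R < ‖x‖ := by rw [hx]; exact hrR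
    have hdet := (hb x (by rw [hx]; exact hrb)).2
    have hx0 : ‖x‖ ≠ 0 := by rw [hx]; exact hr0.ne'
    refine tendsto_finsetSum _ fun j _ => ContinuousAt.mul ?_ (ContinuousAt.div ?_ ?_ hx0)
    · exact (hKd x hxR i j).continuousAt.sub
        ((differentiableAt_traceWrt (hGd x hxR) (hKd x hxR) hdet).continuousAt.mul
          (hGd x hxR i j).continuousAt)
    · exact (by fun_prop : Continuous fun x : Euc n => x j).continuousAt
    · exact continuous_norm.continuousAt
  · intro x hx
    have hxR : R < ‖x‖ := by rw [hx]; exact hrR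
    exact (continuousOn_radialPart hR fun j =>
      (contDiffOn_momentumField H i j).continuousOn).continuousAt
        ((isOpen_exterior R).mem_nhds hxR)

end Decay

/-! ### Weighted norms and the quadratic terms -/

section Sobolev

variable {n : ℕ} {R : ℝ}

theorem lintegral_iterPd_le_sobolevSq {m a : ℕ} (ha : a ≤ m) (w : ℕ → Euc n → ℝ) (Ω : Set (Euc n))
    (f : Euc n → ℝ) (v : Fin a → Fin n) :
    ∫⁻ x in Ω, ENNReal.ofReal (iterPd v f x ^ 2 * w a x) ≤ sobolevSq m w Ω f := by
  unfold sobolevSq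
  refine le_trans ?_ (Finset.single_le_sum (f := fun a => ∑ v : Fin a → Fin n,
    ∫⁻ x in Ω, ENNReal.ofReal (iterPd v f x ^ 2 * w a x)) (fun _ _ => zero_le)
    (Finset.mem_range.2 (Nat.lt_succ_of_le ha)))
  exact Finset.single_le_sum (f := fun v : Fin a → Fin n =>
    ∫⁻ x in Ω, ENNReal.ofReal (iterPd v f x ^ 2 * w a x)) (fun _ _ => zero_le)
    (Finset.mem_univ v)

theorem radialWeight_nonneg (q : ℝ) (a : ℕ) (x : Euc n) : 0 ≤ radialWeight q a x :=
  Real.rpow_nonneg (norm_nonneg _) _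

theorem continuousOn_radialWeight (hR : 0 ≤ R) (q : ℝ) (a : ℕ) :
    ContinuousOn (radialWeight (n := n) q a) {x | R < ‖x‖} :=
  continuous_norm.continuousOn.rpow_const fun _ hx => Or.inl (hR.trans_lt hx).ne'

theorem aemeasurable_iterPd_sq {m a : ℕ} (ha : a ≤ m) (hR : 0 ≤ R) (q : ℝ) {f : Euc n → ℝ}
    (hf : ContDiffOn ℝ m f {x | R < ‖x‖}) (v : Fin a → Fin n) {s : ℝ} (hs : R ≤ s) :
    AEMeasurable (fun x => ENNReal.ofReal (iterPd v f x ^ 2 * radialWeight q a x))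
      (volume.restrict {x | s < ‖x‖}) := by
  have h1 : ContDiffOn ℝ (0 : ℕ) (iterPd v f) {x | R < ‖x‖} :=
    contDiffOn_iterPd (isOpen_exterior R) v
      (hf.of_le (by rw [zero_add]; exact_mod_cast ha))
  have h2 : ContinuousOn (fun x => iterPd v f x ^ 2 * radialWeight q a x) {x | R < ‖x‖} :=
    (h1.continuousOn.pow 2).mul (continuousOn_radialWeight hR q a)
  exact ((h2.mono fun x hx => hs.trans_lt hx).aemeasurable
    (measurableSet_exterior s)).ennreal_ofReal

/-- The triangle inequality for squared norms. -/
theorem sobolevSq_add_le {m : ℕ} (hR : 0 ≤ R) (q : ℝ) {f g : Euc n → ℝ}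
    (hf : ContDiffOn ℝ m f {x | R < ‖x‖}) (hg : ContDiffOn ℝ m g {x | R < ‖x‖}) {s : ℝ}
    (hs : R ≤ s) :
    sobolevSq m (radialWeight q) {x | s < ‖x‖} (fun x => f x + g x) ≤
      2 * sobolevSq m (radialWeight q) {x | s < ‖x‖} f +
        2 * sobolevSq m (radialWeight q) {x | s < ‖x‖} g := by
  unfold sobolevSq
  simp only [Finset.mul_sum, ← Finset.sum_add_distrib]
  refine Finset.sum_le_sum fun a ha => Finset.sum_le_sum fun v _ => ?_
  have ham : a ≤ m := Nat.lt_succ_iff.1 (Finset.mem_range.1 ha)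
  have hle : (a : ℕ∞ω) ≤ (m : ℕ∞ω) := by exact_mod_cast ham
  have hmf := aemeasurable_iterPd_sq ham hR q hf v hs
  rw [← lintegral_const_mul'' _ hmf,
    ← lintegral_const_mul'' _ (aemeasurable_iterPd_sq ham hR q hg v hs),
    ← lintegral_add_left' (hmf.const_mul 2)]
  refine setLIntegral_mono' (measurableSet_exterior s) fun x hx => ?_
  rw [iterPd_add (isOpen_exterior R) v (hf.of_le hle) (hg.of_le hle) (hs.trans_lt hx)]
  have hw := radialWeight_nonneg q a x
  rw [show (2 : ℝ≥0∞) = ENNReal.ofReal 2 by simp, ← ENNReal.ofReal_mul (by norm_num),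
    ← ENNReal.ofReal_mul (by norm_num), ← ENNReal.ofReal_add (by positivity) (by positivity)]
  apply ENNReal.ofReal_le_ofReal
  nlinarith [mul_nonneg (sq_nonneg (iterPd v f x - iterPd v g x)) hw]

/-- The squared weighted norm of all components. -/
def totalSobolevSq (m : ℕ) (q s : ℝ) (f : Fin n → Fin n → Euc n → ℝ) : ℝ≥0∞ :=
  ∑ z : Fin n × Fin n, sobolevSq m (radialWeight q) {x | s < ‖x‖} (f z.1 z.2)

/-- The first cardinality comes from the Cauchy-Schwarz inequality for the finite sum. The second
counts the multi-indices, each derivative being bounded by the whole norm of its component. -/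
theorem lintegral_derivSize_sq_le {m a : ℕ} (ha : a ≤ m) (hR : 0 ≤ R) (q : ℝ)
    {f : Fin n → Fin n → Euc n → ℝ} (hf : ∀ i j, ContDiffOn ℝ m (f i j) {x | R < ‖x‖}) {s : ℝ}
    (hs : R ≤ s) :
    ∫⁻ x in {x | s < ‖x‖}, ENNReal.ofReal (derivSize a f x ^ 2 * radialWeight q a x) ≤
      Fintype.card (Fin n × Fin n × (Fin a → Fin n)) * Fintype.card (Fin a → Fin n) *
        totalSobolevSq m q s f := by
  have hpt : ∀ x, ENNReal.ofReal (derivSize a f x ^ 2 * radialWeight q a x) ≤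
      Fintype.card (Fin n × Fin n × (Fin a → Fin n)) *
        ∑ z : Fin n × Fin n × (Fin a → Fin n),
          ENNReal.ofReal (iterPd z.2.2 (f z.1 z.2.1) x ^ 2 * radialWeight q a x) := by
    intro x
    have hw := radialWeight_nonneg q a x
    rw [← ENNReal.ofReal_sum_of_nonneg fun z _ => by positivity, ← ENNReal.ofReal_natCast,
      ← ENNReal.ofReal_mul (by positivity)]
    apply ENNReal.ofReal_le_ofReal
    rw [← Finset.sum_mul, ← mul_assoc]
    refine mul_le_mul_of_nonneg_right ?_ hw
    have := sq_sum_le_card_mul_sum_sq (s := Finset.univ)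
      (f := fun z : Fin n × Fin n × (Fin a → Fin n) => |iterPd z.2.2 (f z.1 z.2.1) x|)
    simp only [sq_abs, Finset.card_univ] at this
    exact this
  refine (lintegral_mono hpt).trans ?_
  have hmeas := fun z : Fin n × Fin n × (Fin a → Fin n) =>
    aemeasurable_iterPd_sq ha hR q (hf z.1 z.2.1) z.2.2 hs
  rw [lintegral_const_mul'' _ (Finset.aemeasurable_fun_sum _ fun z _ => hmeas z),
    lintegral_finsetSum' _ fun z _ => hmeas z, mul_assoc]
  gcongr
  calc ∑ z : Fin n × Fin n × (Fin a → Fin n), ∫⁻ x in {x | s < ‖x‖},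
        ENNReal.ofReal (iterPd z.2.2 (f z.1 z.2.1) x ^ 2 * radialWeight q a x)
      ≤ ∑ z : Fin n × Fin n × (Fin a → Fin n),
        sobolevSq m (radialWeight q) {x | s < ‖x‖} (f z.1 z.2.1) :=
        Finset.sum_le_sum fun z _ => lintegral_iterPd_le_sobolevSq ha _ _ _ _
    _ = Fintype.card (Fin a → Fin n) * totalSobolevSq m q s f := by
        simp only [totalSobolevSq, Fintype.sum_prod_type, Finset.sum_const, Finset.card_univ,
          nsmul_eq_mul, Finset.mul_sum]

/-- The density of the weighted norms of `(g - δ, k)`. -/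
def density (p : ℝ) (G K : Components n) (x : Euc n) : ℝ :=
  derivSize 0 (deviation G) x ^ 2 * radialWeight p 0 x +
    derivSize 1 (deviation G) x ^ 2 * radialWeight p 1 x +
    derivSize 2 (deviation G) x ^ 2 * radialWeight p 2 x +
    derivSize 0 (entries K) x ^ 2 * radialWeight (p + 1) 0 x +
    derivSize 1 (entries K) x ^ 2 * radialWeight (p + 1) 1 x

theorem aemeasurable_derivSize_sq {m a : ℕ} (ha : a ≤ m) (hR : 0 ≤ R) (q : ℝ)
    {f : Fin n → Fin n → Euc n → ℝ} (hf : ∀ i j, ContDiffOn ℝ m (f i j) {x | R < ‖x‖}) {s : ℝ}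
    (hs : R ≤ s) :
    AEMeasurable (fun x => ENNReal.ofReal (derivSize a f x ^ 2 * radialWeight q a x))
      (volume.restrict {x | s < ‖x‖}) := by
  have h1 : ContinuousOn (derivSize a f) {x | R < ‖x‖} :=
    continuousOn_finsetSum _ fun z _ => (contDiffOn_iterPd (m := 0) (isOpen_exterior R) z.2.2
      ((hf z.1 z.2.1).of_le (by rw [zero_add]; exact_mod_cast ha))).continuousOn.abs
  exact ((((h1.pow 2).mul (continuousOn_radialWeight hR q a)).mono
    fun x hx => hs.trans_lt hx).aemeasurable (measurableSet_exterior s)).ennreal_ofReal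

theorem contDiffOn_deviation {G K : Components n} (H : IsEndVacuum R G K) (i j : Fin n) :
    ContDiffOn ℝ (2 : ℕ) (deviation G i j) {x | R < ‖x‖} :=
  (H.contDiffOn_g i j).sub contDiffOn_const

theorem contDiffOn_entries {G K : Components n} (H : IsEndVacuum R G K) (i j : Fin n) :
    ContDiffOn ℝ (1 : ℕ) (entries K i j) {x | R < ‖x‖} := by
  exact_mod_cast H.contDiffOn_k i j

theorem exists_lintegral_density_le (hR : 0 ≤ R) (p : ℝ) :
    ∃ N : ℝ≥0∞, N ≠ ⊤ ∧ ∀ G K : Components n, IsEndVacuum R G K → ∀ s, R ≤ s →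
      ∫⁻ x in {x | s < ‖x‖}, ENNReal.ofReal (density p G K x) ≤
        N * (totalSobolevSq 2 p s (deviation G) + totalSobolevSq 1 (p + 1) s (entries K)) := by
  let c : ℕ → ℝ≥0∞ := fun a =>
    Fintype.card (Fin n × Fin n × (Fin a → Fin n)) * Fintype.card (Fin a → Fin n)
  have hc : ∀ a, c a ≠ ⊤ := fun a =>
    ENNReal.mul_ne_top (ENNReal.natCast_ne_top _) (ENNReal.natCast_ne_top _)
  refine ⟨c 0 + c 1 + c 2 + c 0 + c 1, by simp [hc], fun G K H s hs => ?_⟩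
  have hG := contDiffOn_deviation H
  have hK := contDiffOn_entries H
  have w := fun (q : ℝ) a x => radialWeight_nonneg (n := n) q a x
  have nn := fun q a f x => mul_nonneg (sq_nonneg (derivSize (n := n) a f x)) (w q a x)
  have b0 := lintegral_derivSize_sq_le (a := 0) (by norm_num) hR p hG hs
  have b1 := lintegral_derivSize_sq_le (a := 1) (by norm_num) hR p hG hs
  have b2 := lintegral_derivSize_sq_le (a := 2) le_rfl hR p hG hs
  have k0 := lintegral_derivSize_sq_le (a := 0) (by norm_num) hR (p + 1) hK hs
  have k1 := lintegral_derivSize_sq_le (a := 1) le_rfl hR (p + 1) hK hs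
  have m1 := aemeasurable_derivSize_sq (a := 1) (by norm_num) hR p hG hs
  have m2 := aemeasurable_derivSize_sq (a := 2) le_rfl hR p hG hs
  have m3 := aemeasurable_derivSize_sq (a := 0) (by norm_num) hR (p + 1) hK hs
  have m4 := aemeasurable_derivSize_sq (a := 1) le_rfl hR (p + 1) hK hs
  have hsplit : ∀ x, ENNReal.ofReal (density p G K x) =
      ENNReal.ofReal (derivSize 0 (deviation G) x ^ 2 * radialWeight p 0 x) +
      ENNReal.ofReal (derivSize 1 (deviation G) x ^ 2 * radialWeight p 1 x) +
      ENNReal.ofReal (derivSize 2 (deviation G) x ^ 2 * radialWeight p 2 x) +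
      ENNReal.ofReal (derivSize 0 (entries K) x ^ 2 * radialWeight (p + 1) 0 x) +
      ENNReal.ofReal (derivSize 1 (entries K) x ^ 2 * radialWeight (p + 1) 1 x) := by
    intro x
    unfold density
    have e0 := nn p 0 (deviation G) x
    have e1 := nn p 1 (deviation G) x
    have e2 := nn p 2 (deviation G) x
    have e3 := nn (p + 1) 0 (entries K) x
    have e4 := nn (p + 1) 1 (entries K) x
    rw [ENNReal.ofReal_add (by positivity) e4, ENNReal.ofReal_add (by positivity) e3,
      ENNReal.ofReal_add (by positivity) e2, ENNReal.ofReal_add e0 e1]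
  simp only [hsplit]
  rw [lintegral_add_right' _ m4, lintegral_add_right' _ m3, lintegral_add_right' _ m2,
    lintegral_add_right' _ m1]
  refine (add_le_add (add_le_add (add_le_add (add_le_add b0 b1) b2) k0) k1).trans ?_
  rw [add_mul, add_mul, add_mul, add_mul]
  gcongr
  · exact le_self_add
  · exact le_self_add
  · exact le_self_add
  · exact le_add_self
  · exact le_add_self

theorem radialWeight_eq {q θ : ℝ} {a : ℕ} {x : Euc n} (h : -(n : ℝ) + 2 * (a + q) = θ) :
    radialWeight q a x = ‖x‖ ^ θ := by
  rw [radialWeight, h]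

/-- Products of the sizes of the derivatives which scale like the constraints are controlled by
the density, with a gain of a negative power of the radius. -/
theorem products_le_density {p s : ℝ} (hp : ((n : ℝ) - 2) / 2 < p) (hs : 0 < s)
    (G K : Components n) {x : Euc n} (hx : s < ‖x‖) :
    derivSize 0 (deviation G) x * derivSize 2 (deviation G) x +
        derivSize 1 (deviation G) x ^ 2 + derivSize 0 (entries K) x ^ 2 ≤
      s ^ (-(2 * p - (n - 2))) * density p G K x ∧
    derivSize 0 (deviation G) x * derivSize 1 (entries K) x +
        derivSize 1 (deviation G) x * derivSize 0 (entries K) x ≤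
      s ^ (-(2 * p - (n - 2))) * density p G K x := by
  -- The exponent θ is positive by the choice of p. The weights of h, d, d₂, κ, κ₁ are |x|^θ times
  -- |x|^{-2}, 1, |x|², 1, |x|², so |x|^θ factors out of the density.
  set θ : ℝ := 2 * p - (n - 2) with hθ
  have hθ0 : 0 < θ := by linarith
  have hx0 : 0 < ‖x‖ := hs.trans hx
  set ρ := ‖x‖ with hρ
  set W := ρ ^ θ with hW
  have hW0 : 0 < W := Real.rpow_pos_of_pos hx0 _
  have w0 : radialWeight p 0 x = W * (ρ ^ 2)⁻¹ := by
    rw [radialWeight_eq (θ := θ + (-2 : ℝ)) (by push_cast; ring), Real.rpow_add hx0,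
      Real.rpow_neg hx0.le]
    norm_cast
  have w1 : radialWeight p 1 x = W := radialWeight_eq (by push_cast; ring)
  have w2 : radialWeight p 2 x = W * ρ ^ 2 := by
    rw [radialWeight_eq (θ := θ + (2 : ℝ)) (by push_cast; ring), Real.rpow_add hx0]
    norm_cast
  have v0 : radialWeight (p + 1) 0 x = W := radialWeight_eq (by push_cast; ring)
  have v1 : radialWeight (p + 1) 1 x = W * ρ ^ 2 := by
    rw [radialWeight_eq (θ := θ + (2 : ℝ)) (by push_cast; ring), Real.rpow_add hx0]
    norm_cast
  unfold density
  rw [w0, w1, w2, v0, v1]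
  generalize derivSize 0 (deviation G) x = h
  generalize derivSize 1 (deviation G) x = d
  generalize derivSize 2 (deviation G) x = d₂
  generalize derivSize 0 (entries K) x = κ
  generalize derivSize 1 (entries K) x = κ₁
  have hfac : h ^ 2 * (W * (ρ ^ 2)⁻¹) + d ^ 2 * W + d₂ ^ 2 * (W * ρ ^ 2) + κ ^ 2 * W +
      κ₁ ^ 2 * (W * ρ ^ 2) =
      W * (h ^ 2 * (ρ ^ 2)⁻¹ + d ^ 2 + d₂ ^ 2 * ρ ^ 2 + κ ^ 2 + κ₁ ^ 2 * ρ ^ 2) := by ring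
  have hsW : 1 ≤ s ^ (-θ) * W := by
    rw [Real.rpow_neg hs.le, inv_mul_eq_div, one_le_div (Real.rpow_pos_of_pos hs _)]
    exact Real.rpow_le_rpow hs.le hx.le hθ0.le
  -- The products pair weights |x|^{-2} and |x|²: ab = (a/|x|)(b|x|), followed by the
  -- arithmetic-geometric inequality.
  have hprod : ∀ a b : ℝ, 2 * (a * b) ≤ a ^ 2 * (ρ ^ 2)⁻¹ + b ^ 2 * ρ ^ 2 := by
    intro a b
    have h1 : a ^ 2 * (ρ ^ 2)⁻¹ = (a * ρ⁻¹) ^ 2 := by rw [mul_pow, inv_pow]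
    have h2 : a * b = (a * ρ⁻¹) * (b * ρ) := by field_simp
    rw [h1, h2]
    nlinarith [sq_nonneg (a * ρ⁻¹ - b * ρ)]
  set T := h ^ 2 * (ρ ^ 2)⁻¹ + d ^ 2 + d₂ ^ 2 * ρ ^ 2 + κ ^ 2 + κ₁ ^ 2 * ρ ^ 2 with hT
  have hT0 : 0 ≤ T := by positivity
  have hkey : T ≤ s ^ (-θ) * (W * T) := by
    rw [← mul_assoc]
    exact le_mul_of_one_le_left hT0 hsW
  rw [hfac]
  have q1 : 0 ≤ h ^ 2 * (ρ ^ 2)⁻¹ := by positivity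
  have q2 : 0 ≤ d₂ ^ 2 * ρ ^ 2 := by positivity
  have q3 : 0 ≤ κ₁ ^ 2 * ρ ^ 2 := by positivity
  constructor <;> refine le_trans ?_ hkey
  · have := hprod h d₂
    linarith
  · have := hprod h κ₁
    nlinarith [sq_nonneg (d - κ), sq_nonneg d, sq_nonneg κ]

end Sobolev

/-! ### From L² to L¹ on sets of finite measure -/

section LocalConvergence

variable {n : ℕ}

/-- On a set of finite measure, `L²` convergence to zero implies `L¹` convergence to zero. -/
theorem tendsto_lintegral_enorm_of_sq {K : Set (Euc n)} (hK : volume K ≠ ⊤)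
    {f : ℕ → Euc n → ℝ} (hf : ∀ l, AEMeasurable (f l) (volume.restrict K))
    (h : Tendsto (fun l => ∫⁻ x in K, ENNReal.ofReal (f l x ^ 2)) atTop (𝓝 0)) :
    Tendsto (fun l => ∫⁻ x in K, ‖f l x‖ₑ) atTop (𝓝 0) := by
  have hle : ∀ l, ∫⁻ x in K, ‖f l x‖ₑ ≤
      (∫⁻ x in K, ENNReal.ofReal (f l x ^ 2)) ^ (1 / 2 : ℝ) * volume K ^ (1 / 2 : ℝ) := by
    intro l
    have := ENNReal.lintegral_mul_le_Lp_mul_Lq (volume.restrict K) Real.HolderConjugate.two_two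
      (hf l).enorm (g := fun _ => 1) aemeasurable_const
    simp only [Pi.mul_apply, mul_one, ENNReal.one_rpow, lintegral_one, Measure.restrict_apply,
      MeasurableSet.univ, univ_inter] at this
    refine this.trans (le_of_eq ?_)
    congr 3
    ext x
    rw [← ofReal_norm, ENNReal.ofReal_rpow_of_nonneg (norm_nonneg _) (by norm_num),
      Real.norm_eq_abs, Real.rpow_two, sq_abs]
  refine tendsto_of_tendsto_of_tendsto_of_le_of_le tendsto_const_nhds ?_ (fun _ => zero_le) hle
  have h1 : Tendsto (fun l => (∫⁻ x in K, ENNReal.ofReal (f l x ^ 2)) ^ (1 / 2 : ℝ)) atTop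
      (𝓝 (0 ^ (1 / 2 : ℝ))) := h.ennrpow_const _
  rw [ENNReal.zero_rpow_of_pos (by norm_num)] at h1
  have h2 := ENNReal.Tendsto.mul_const h1 (b := volume K ^ (1 / 2 : ℝ))
    (Or.inr (ENNReal.rpow_ne_top_of_nonneg (by norm_num) hK))
  simpa using h2

end LocalConvergence

/-! ### Uniform tails and convergence on compact shells -/

section Uniform

variable {n : ℕ} {R : ℝ}

/-- Quantities bounded by a negative power of the radius times the density are uniformly small in
`L¹` near infinity, over families with bounded weighted norms. -/
theorem exists_forall_lintegral_le (hR : 0 ≤ R) {p : ℝ} (hp : ((n : ℝ) - 2) / 2 < p)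
    {ι : Type*} {G K : ι → Components n} (H : ∀ a, IsEndVacuum R (G a) (K a))
    {f u : ι × Euc n → ℝ} (hf : f =O[𝓟 {t | R < ‖t.2‖}] u) (hu : ∀ t, 0 ≤ u t)
    (hud : ∀ s : ℝ, 0 < s → ∀ t : ι × Euc n, s < ‖t.2‖ →
      u t ≤ s ^ (-(2 * p - (n - 2))) * density p (G t.1) (K t.1) t.2)
    {s₀ : ℝ} (hs₀ : R < s₀) {B : ℝ≥0∞} (hB : B ≠ ⊤) {ε : ℝ} (hε : 0 < ε) :
    ∃ s, R < s ∧ ∀ a, totalSobolevSq 2 p s₀ (deviation (G a)) +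
        totalSobolevSq 1 (p + 1) s₀ (entries (K a)) ≤ B →
      ∫⁻ x in {x | s < ‖x‖}, ‖f (a, x)‖ₑ ≤ ENNReal.ofReal ε := by
  obtain ⟨C, hC0, hC⟩ := hf.exists_nonneg
  have hC' : ∀ t : ι × Euc n, R < ‖t.2‖ → |f t| ≤ C * u t := by
    intro t ht
    have := (Asymptotics.isBigOWith_principal.1 hC) t ht
    rwa [Real.norm_eq_abs, Real.norm_eq_abs, abs_of_nonneg (hu t)] at this
  obtain ⟨N, hN, hNd⟩ := exists_lintegral_density_le (n := n) hR p
  -- The norm bound is taken on the fixed exterior |x| > s₀. Only the gain s^{-(2p-(n-2))} depends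
  -- on s, and s is chosen afterwards, independently of the member of the family.
  have hlim : Tendsto (fun s : ℝ => ENNReal.ofReal (C * s ^ (-(2 * p - (n - 2)))) * (N * B)) atTop
      (𝓝 0) := by
    have h1 : Tendsto (fun s : ℝ => C * s ^ (-(2 * p - (n - 2)))) atTop (𝓝 0) := by
      simpa using (tendsto_rpow_neg_atTop (y := 2 * p - (n - 2)) (by linarith)).const_mul C
    have h2 := ENNReal.Tendsto.mul_const (ENNReal.tendsto_ofReal h1) (b := N * B)
      (Or.inr (ENNReal.mul_ne_top hN hB))
    simpa using h2
  obtain ⟨s, hs1, hs2⟩ := ((hlim.eventually_le_const (u := ENNReal.ofReal ε)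
    (by simpa using hε)).and (eventually_ge_atTop s₀)).exists
  have hRs : R < s := hs₀.trans_le hs2
  have hs0 : 0 < s := hR.trans_lt hRs
  refine ⟨s, hRs, fun a ha => le_trans ?_ hs1⟩
  have hsub : {x : Euc n | s < ‖x‖} ⊆ {x | s₀ < ‖x‖} := fun x hx => hs2.trans_lt hx
  calc ∫⁻ x in {x | s < ‖x‖}, ‖f (a, x)‖ₑ
      ≤ ∫⁻ x in {x | s < ‖x‖}, ENNReal.ofReal (C * s ^ (-(2 * p - (n - 2)))) *
          ENNReal.ofReal (density p (G a) (K a) x) := by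
        refine setLIntegral_mono' (measurableSet_exterior s) fun x hx => ?_
        rw [← ofReal_norm, ← ENNReal.ofReal_mul (by positivity)]
        apply ENNReal.ofReal_le_ofReal
        rw [Real.norm_eq_abs, mul_assoc]
        exact (hC' (a, x) (hRs.trans hx)).trans
          (mul_le_mul_of_nonneg_left (hud s hs0 (a, x) hx) hC0)
    _ = ENNReal.ofReal (C * s ^ (-(2 * p - (n - 2)))) *
          ∫⁻ x in {x | s < ‖x‖}, ENNReal.ofReal (density p (G a) (K a) x) :=
        lintegral_const_mul' _ _ ENNReal.ofReal_ne_top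
    _ ≤ ENNReal.ofReal (C * s ^ (-(2 * p - (n - 2)))) *
          ∫⁻ x in {x | s₀ < ‖x‖}, ENNReal.ofReal (density p (G a) (K a) x) := by
        gcongr
    _ ≤ ENNReal.ofReal (C * s ^ (-(2 * p - (n - 2)))) * (N * B) := by
        gcongr
        refine (hNd (G a) (K a) (H a) s₀ hs₀.le).trans ?_
        gcongr

/-- Write f_l = (f_l - f') + f'. The squared norm of the difference is eventually at most 1, and the
squared triangle inequality contributes the factors 2. -/
theorem eventually_totalSobolevSq_le {m : ℕ} (hR : 0 ≤ R) (q : ℝ)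
    {f : ℕ → Fin n → Fin n → Euc n → ℝ} {f' : Fin n → Fin n → Euc n → ℝ}
    (hf : ∀ l i j, ContDiffOn ℝ m (f l i j) {x | R < ‖x‖})
    (hf' : ∀ i j, ContDiffOn ℝ m (f' i j) {x | R < ‖x‖}) {s : ℝ} (hs : R ≤ s)
    (h : ∀ i j, Tendsto (fun l => sobolevSq m (radialWeight q) {x | s < ‖x‖}
      fun x => f l i j x - f' i j x) atTop (𝓝 0)) :
    ∀ᶠ l in atTop, totalSobolevSq m q s (f l) ≤ 2 + 2 * totalSobolevSq m q s f' := by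
  have hsum : Tendsto (fun l => ∑ z : Fin n × Fin n, sobolevSq m (radialWeight q) {x | s < ‖x‖}
      fun x => f l z.1 z.2 x - f' z.1 z.2 x) atTop (𝓝 0) := by
    simpa using tendsto_finsetSum Finset.univ fun (z : Fin n × Fin n) _ => h z.1 z.2
  filter_upwards [hsum.eventually_le_const (u := 1) (by simp)] with l hl
  have h1 : totalSobolevSq m q s (f l) ≤
      ∑ z : Fin n × Fin n, (2 * (sobolevSq m (radialWeight q) {x | s < ‖x‖}
        fun x => f l z.1 z.2 x - f' z.1 z.2 x) +
        2 * sobolevSq m (radialWeight q) {x | s < ‖x‖} (f' z.1 z.2)) := by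
    refine Finset.sum_le_sum fun z _ => ?_
    have := sobolevSq_add_le hR q ((hf l z.1 z.2).sub (hf' z.1 z.2)) (hf' z.1 z.2) hs
    simpa using this
  refine h1.trans ?_
  rw [Finset.sum_add_distrib, ← Finset.mul_sum, ← Finset.mul_sum]
  refine add_le_add ?_ le_rfl
  exact (mul_le_mul_right hl 2).trans (by simp)

theorem tendsto_lintegral_of_enorm_le_sum {ζ : Type*} [Fintype ζ] {S : Set (Euc n)}
    (hS : MeasurableSet S) {F : ℕ → Euc n → ℝ} {g : ζ → ℕ → Euc n → ℝ}
    (hg : ∀ z l, AEMeasurable (g z l) (volume.restrict S))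
    (hle : ∀ l, ∀ x ∈ S, ‖F l x‖ₑ ≤ ∑ z, ‖g z l x‖ₑ)
    (hlim : ∀ z, Tendsto (fun l => ∫⁻ x in S, ‖g z l x‖ₑ) atTop (𝓝 0)) :
    Tendsto (fun l => ∫⁻ x in S, ‖F l x‖ₑ) atTop (𝓝 0) := by
  have hsum : Tendsto (fun l => ∑ z, ∫⁻ x in S, ‖g z l x‖ₑ) atTop (𝓝 0) := by
    simpa using tendsto_finsetSum Finset.univ fun z _ => hlim z
  refine tendsto_of_tendsto_of_tendsto_of_le_of_le tendsto_const_nhds hsum (fun _ => zero_le)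
    fun l => ?_
  refine (setLIntegral_mono' hS (hle l)).trans (le_of_eq ?_)
  exact lintegral_finsetSum' _ fun z _ => (hg z l).enorm

theorem tendsto_lintegral_iterPd {m a : ℕ} (ha : a ≤ m) {b c : ℝ} (hb : R < b)
    {f : ℕ → Euc n → ℝ} (hf : ∀ l, ContDiffOn ℝ m (f l) {x | R < ‖x‖})
    (h : Tendsto (fun l => sobolevSq m (fun _ _ => 1) {x | b ≤ ‖x‖ ∧ ‖x‖ ≤ c} (f l)) atTop (𝓝 0))
    (v : Fin a → Fin n) :
    Tendsto (fun l => ∫⁻ x in {x | b ≤ ‖x‖ ∧ ‖x‖ ≤ c}, ‖iterPd v (f l) x‖ₑ) atTop (𝓝 0) ∧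
      ∀ l, AEMeasurable (iterPd v (f l)) (volume.restrict {x | b ≤ ‖x‖ ∧ ‖x‖ ≤ c}) := by
  have hK := isCompact_annulus (n := n) b c
  have hm : ∀ l, AEMeasurable (iterPd v (f l)) (volume.restrict {x | b ≤ ‖x‖ ∧ ‖x‖ ≤ c}) := by
    intro l
    refine ContinuousOn.aemeasurable ?_ hK.measurableSet
    refine (contDiffOn_iterPd (m := 0) (isOpen_exterior R) v ((hf l).of_le ?_)).continuousOn.mono
      fun x hx => hb.trans_le hx.1
    rw [zero_add]
    exact_mod_cast ha
  refine ⟨tendsto_lintegral_enorm_of_sq hK.measure_lt_top.ne hm ?_, hm⟩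
  refine tendsto_of_tendsto_of_tendsto_of_le_of_le tendsto_const_nhds h (fun _ => zero_le)
    fun l => ?_
  simpa using lintegral_iterPd_le_sobolevSq ha (fun _ _ => 1) {x | b ≤ ‖x‖ ∧ ‖x‖ ≤ c} (f l) v

variable {G K : ℕ → Components n} {G' K' : Components n}

theorem tendsto_lintegral_energyField (H : ∀ l, IsEndVacuum R (G l) (K l))
    (H' : IsEndVacuum R G' K') {b c : ℝ} (hb : R < b)
    (h : ∀ i j, Tendsto (fun l => sobolevSq 2 (fun _ _ => 1) {x | b ≤ ‖x‖ ∧ ‖x‖ ≤ c}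
      fun x => G l x i j - G' x i j) atTop (𝓝 0)) (j : Fin n) :
    Tendsto (fun l => ∫⁻ x in {x | b ≤ ‖x‖ ∧ ‖x‖ ≤ c},
      ‖energyField (G l) j x - energyField G' j x‖ₑ) atTop (𝓝 0) := by
  have hd : ∀ i j l, ContDiffOn ℝ (2 : ℕ) (fun x => G l x i j - G' x i j) {x | R < ‖x‖} :=
    fun i j l => ((H l).contDiffOn_g i j).sub (H'.contDiffOn_g i j)
  have key := fun i j k => tendsto_lintegral_iterPd (a := 1) (by norm_num) hb (hd i j) (h i j)
    fun _ => k
  simp only [iterPd_one] at key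
  -- The two copies of `Fin n` index the terms ∂_i g_ij and ∂_j g_ii.
  refine tendsto_lintegral_of_enorm_le_sum (ζ := Fin n ⊕ Fin n)
    (g := Sum.elim (fun i l => pd i fun x => G l x i j - G' x i j)
      (fun i l => pd j fun x => G l x i i - G' x i i))
    (isCompact_annulus b c).measurableSet ?_ ?_ ?_
  · rintro (i | i) l
    · exact (key i j i).2 l
    · exact (key i i j).2 l
  · intro l x hx
    have hxR : R < ‖x‖ := hb.trans_le hx.1
    have hg : ∀ i j, DifferentiableAt ℝ (fun y => G l y i j) x := fun i j =>
      (((H l).contDiffOn_g i j).contDiffAt ((isOpen_exterior R).mem_nhds hxR)).differentiableAt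
        (by simp)
    have hg' : ∀ i j, DifferentiableAt ℝ (fun y => G' y i j) x := fun i j =>
      ((H'.contDiffOn_g i j).contDiffAt ((isOpen_exterior R).mem_nhds hxR)).differentiableAt
        (by simp)
    have e : energyField (G l) j x - energyField G' j x =
        ∑ i, pd i (fun x => G l x i j - G' x i j) x +
          ∑ i, -pd j (fun x => G l x i i - G' x i i) x := by
      simp only [energyField, pd_sub (hg _ _) (hg' _ _), ← Finset.sum_add_distrib,
        ← Finset.sum_sub_distrib]
      exact Finset.sum_congr rfl fun i _ => by ring
    rw [e, Fintype.sum_sum_type]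
    refine (enorm_add_le _ _).trans (add_le_add (enorm_sum_le _ _) ?_)
    refine (enorm_sum_le _ _).trans (Finset.sum_le_sum fun i _ => ?_)
    rw [enorm_neg]
    rfl
  · rintro (i | i)
    · exact (key i j i).1
    · exact (key i i j).1

theorem tendsto_lintegral_momentumField (H : ∀ l, IsEndVacuum R (G l) (K l))
    (H' : IsEndVacuum R G' K') {b c : ℝ} (hb : R < b)
    (h : ∀ i j, Tendsto (fun l => sobolevSq 1 (fun _ _ => 1) {x | b ≤ ‖x‖ ∧ ‖x‖ ≤ c}
      fun x => K l x i j - K' x i j) atTop (𝓝 0)) (i j : Fin n) :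
    Tendsto (fun l => ∫⁻ x in {x | b ≤ ‖x‖ ∧ ‖x‖ ≤ c},
      ‖momentumField (K l) i j x - momentumField K' i j x‖ₑ) atTop (𝓝 0) := by
  have hd : ∀ i j l, ContDiffOn ℝ (1 : ℕ) (fun x => K l x i j - K' x i j) {x | R < ‖x‖} :=
    fun i j l => (contDiffOn_entries (H l) i j).sub (contDiffOn_entries H' i j)
  have key := fun i j => tendsto_lintegral_iterPd (a := 0) (by norm_num) hb (hd i j) (h i j) ![]
  simp only [iterPd_zero] at key
  -- The entry k_ij accounts for `Unit`, the diagonal entries of the trace for `Fin n`.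
  refine tendsto_lintegral_of_enorm_le_sum (ζ := Unit ⊕ Fin n)
    (g := Sum.elim (fun _ l x => K l x i j - K' x i j) (fun a l x => K l x a a - K' x a a))
    (isCompact_annulus b c).measurableSet ?_ ?_ ?_
  · rintro (_ | a) l
    · exact (key i j).2 l
    · exact (key a a).2 l
  · intro l x _
    have e : momentumField (K l) i j x - momentumField K' i j x = (K l x i j - K' x i j) +
        ∑ a, (K l x a a - K' x a a) * -(1 : Matrix (Fin n) (Fin n) ℝ) i j := by
      simp only [momentumField, ← Finset.sum_mul, Finset.sum_sub_distrib]
      ring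
    rw [e, Fintype.sum_sum_type]
    refine (enorm_add_le _ _).trans (add_le_add (by simp) ?_)
    refine (enorm_sum_le _ _).trans (Finset.sum_le_sum fun a _ => ?_)
    rw [enorm_mul, enorm_neg]
    refine mul_le_of_le_one_right' ?_
    rw [Matrix.one_apply]
    split_ifs <;> simp
  · rintro (_ | a)
    · exact (key i j).1
    · exact (key a a).1

end Uniform

/-! ### Passage from the manifold to the end -/

section Assembly

variable {n : ℕ} {M : Type*} [TopologicalSpace M] [ChartedSpace (Euc n) M]
  [IsManifold (𝓡 n) ∞ M]

theorem isEndVacuum_components {e : EndChart n M} {D : InitialData n M}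
    (hD : IsAsymptoticallyFlatVacuum e D) :
    IsEndVacuum e.radius (components D.g.inner e.chart) (components D.k e.chart) where
  contDiffOn_g i j := by
    have := contDiffOn_components (T := D.g.inner) (m := 2) D.g.contMDiff e.chart_mem i j
    rwa [e.target_eq] at this
  contDiffOn_k i j := by
    have := contDiffOn_components (T := D.k) (m := 1) (by exact_mod_cast D.k_contMDiff)
      e.chart_mem i j
    rw [e.target_eq] at this
    exact_mod_cast this
  constraints x hx := hD.constraints e.chart e.chart_mem x (by rw [e.target_eq]; exact hx)

theorem energyFlux_eq (G : Components n) (r : ℝ) :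
    energyFlux G r = 1 / (2 * ((n : ℝ) - 1) * sphereArea n) *
      sphereIntegral r (radialPart (energyField G)) := by
  unfold energyFlux
  congr 2
  ext x
  simp only [radialPart, energyField, Finset.sum_mul]
  exact Finset.sum_comm

end Assembly

end ADM

end

/-! ### Convergence of the ADM energy and momentum -/

open ADM in
theorem proposition5 {n : ℕ} (hn : 3 ≤ n)
    {M : Type*} [TopologicalSpace M] [T2Space M] [SecondCountableTopology M]
    [ChartedSpace (ADM.Euc n) M] [IsManifold (𝓡 n) ∞ M]
    (e : ADM.EndChart n M) (p : ℝ) (hp : ((n : ℝ) - 2) / 2 < p)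
    (Dinf : ADM.InitialData n M) (hDinf : ADM.IsAsymptoticallyFlatVacuum e Dinf)
    (hginf : ADM.MemWeightedSobolev e 2 p 1 Dinf.g.inner)
    (hkinf : ADM.MemWeightedSobolev e 1 (p + 1) 0 Dinf.k)
    (D : ℕ → ADM.InitialData n M) (hD : ∀ l, ADM.IsAsymptoticallyFlatVacuum e (D l))
    (hg : ADM.TendstoWeightedSobolev e 2 p (fun l => (D l).g.inner) Dinf.g.inner)
    (hk : ADM.TendstoWeightedSobolev e 1 (p + 1) (fun l => (D l).k) Dinf.k) :
    ∃ (E : ℕ → ℝ) (Einf : ℝ) (P : ℕ → Fin n → ℝ) (Pinf : Fin n → ℝ),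
      (∀ l, ADM.HasADMEnergy e (D l) (E l)) ∧ ADM.HasADMEnergy e Dinf Einf ∧
      (∀ l, ADM.HasADMMomentum e (D l) (P l)) ∧ ADM.HasADMMomentum e Dinf Pinf ∧
      Tendsto E atTop (𝓝 Einf) ∧ Tendsto P atTop (𝓝 Pinf) := by
  have hn0 : 0 < n := by omega
  set R := e.radius with hRdef
  have hR : 0 ≤ R := e.radius_pos.le
  -- the data as a family indexed by `Option ℕ`
  let 𝒟 : Option ℕ → InitialData n M := fun a => a.elim Dinf D
  let G : Option ℕ → Components n := fun a => components (𝒟 a).g.inner e.chart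
  let K : Option ℕ → Components n := fun a => components (𝒟 a).k e.chart
  have hAF : ∀ a, IsAsymptoticallyFlatVacuum e (𝒟 a) := by
    rintro (_ | l)
    exacts [hDinf, hD l]
  have H : ∀ a, IsEndVacuum R (G a) (K a) := fun a => isEndVacuum_components (hAF a)
  -- The decay rates depend on the member and serve only for the existence of the limits; all
  -- uniformity comes from `p`.
  choose q hq hdec using fun a => (hAF a).decay
  have hdg : ∀ a i j, DecaysToOrder 2 (q a) (deviation (G a) i j) := fun a i j => (hdec a i j).1
  have hdk : ∀ a i j, DecaysToOrder 1 (q a + 1) (entries (K a) i j) := fun a i j => (hdec a i j).2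
  choose E hE using fun a => exists_tendsto_energy_flux hn0 hR (H a) (hq a) (hdg a) (hdk a)
  choose P hP using fun a => exists_tendsto_momentum_flux hn0 hR (H a) (hq a) (hdg a) (hdk a)
  -- bounded weighted norms
  set s₀ := R + 1
  have hs₀ : R < s₀ := lt_add_one R
  have fing : totalSobolevSq 2 p s₀ (deviation (G none)) ≠ ⊤ :=
    ENNReal.sum_ne_top.2 fun z _ => (hginf.2 s₀ hs₀ z.1 z.2).ne
  have fink : totalSobolevSq 1 (p + 1) s₀ (entries (K none)) ≠ ⊤ := by
    refine ENNReal.sum_ne_top.2 fun z _ => ?_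
    have := (hkinf.2 s₀ hs₀ z.1 z.2).ne
    simp only [Matrix.zero_apply, sub_zero] at this
    exact this
  set B : ℝ≥0∞ := (2 + 2 * totalSobolevSq 2 p s₀ (deviation (G none))) +
    (2 + 2 * totalSobolevSq 1 (p + 1) s₀ (entries (K none))) with hBdef
  have hB : B ≠ ⊤ := by
    simp [hBdef, ENNReal.mul_eq_top, fing, fink]
  have hBnone : totalSobolevSq 2 p s₀ (deviation (G none)) +
      totalSobolevSq 1 (p + 1) s₀ (entries (K none)) ≤ B := by
    -- The bound obtained for the tail of the sequence holds trivially for the limit itself.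
    have aux : ∀ T : ℝ≥0∞, T ≤ 2 + 2 * T := fun T =>
      le_add_left (le_mul_of_one_le_left' one_le_two)
    exact add_le_add (aux _) (aux _)
  have hBev : ∀ᶠ l in atTop, totalSobolevSq 2 p s₀ (deviation (G (some l))) +
      totalSobolevSq 1 (p + 1) s₀ (entries (K (some l))) ≤ B := by
    have h1 := eventually_totalSobolevSq_le (f := fun l => deviation (G (some l))) hR p
      (fun l => contDiffOn_deviation (H (some l))) (contDiffOn_deviation (H none)) hs₀.le
      fun i j => by
        -- The flat background cancels in differences, so convergence of g_l is convergence of the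
        -- deviations.
        simp only [deviation, sub_sub_sub_cancel_right]
        exact hg.2 s₀ hs₀ i j
    have h2 := eventually_totalSobolevSq_le (f := fun l => entries (K (some l))) hR (p + 1)
      (fun l => contDiffOn_entries (H (some l))) (contDiffOn_entries (H none)) hs₀.le
      fun i j => hk.2 s₀ hs₀ i j
    filter_upwards [h1, h2] with l h1 h2
    exact add_le_add h1 h2
  have hann : ∀ b c, R < b → {x : Euc n | b ≤ ‖x‖ ∧ ‖x‖ ≤ c} ⊆ e.chart.target := by
    intro b c hb x hx
    rw [e.target_eq]
    exact hb.trans_le hx.1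
  -- convergence of the fluxes
  have hEt : Tendsto (fun l => E (some l)) atTop (𝓝 (E none)) := by
    refine tendsto_flux_limit hn0 hR (fun l => contDiffOn_energyField (H (some l)))
      (contDiffOn_energyField (H none)) (fun l => hE (some l)) (hE none) ?_ ?_
    · intro ε hε
      obtain ⟨s, hs, hsm⟩ := exists_forall_lintegral_le hR hp H
        (flatDiv_energyField_isBigO hn0 H)
        (fun t => add_nonneg (add_nonneg (mul_nonneg (derivSize_nonneg _ _ _)
          (derivSize_nonneg _ _ _)) (sq_nonneg _)) (sq_nonneg _))
        (fun s hs t ht => (products_le_density hp hs (G t.1) (K t.1) ht).1) hs₀ hB hε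
      exact ⟨s, hs, hBev.mono fun l hl => hsm (some l) hl, hsm none hBnone⟩
    · exact fun b c hb j => tendsto_lintegral_energyField (fun l => H (some l)) (H none) hb
        (fun i j => hg.1 e.chart e.chart_mem _ (hann b c hb) (isCompact_annulus b c) i j) j
  have hPt : ∀ i, Tendsto (fun l => P (some l) i) atTop (𝓝 (P none i)) := by
    intro i
    refine tendsto_flux_limit hn0 hR (fun l => contDiffOn_momentumField (H (some l)) i)
      (contDiffOn_momentumField (H none) i) (fun l => hP (some l) i) (hP none i) ?_ ?_
    · intro ε hε
      obtain ⟨s, hs, hsm⟩ := exists_forall_lintegral_le hR hp H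
        (flatDiv_momentumField_isBigO hn0 H i)
        (fun t => add_nonneg (mul_nonneg (derivSize_nonneg _ _ _) (derivSize_nonneg _ _ _))
          (mul_nonneg (derivSize_nonneg _ _ _) (derivSize_nonneg _ _ _)))
        (fun s hs t ht => (products_le_density hp hs (G t.1) (K t.1) ht).2) hs₀ hB hε
      exact ⟨s, hs, hBev.mono fun l hl => hsm (some l) hl, hsm none hBnone⟩
    · exact fun b c hb j => tendsto_lintegral_momentumField (fun l => H (some l)) (H none) hb
        (fun i j => hk.1 e.chart e.chart_mem _ (hann b c hb) (isCompact_annulus b c) i j) i j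
  have hen : ∀ a, HasADMEnergy e (𝒟 a) (1 / (2 * ((n : ℝ) - 1) * sphereArea n) * E a) := by
    intro a
    unfold HasADMEnergy
    simp only [funext (energyFlux_eq (G a)), G]
    exact (hE a).const_mul _
  have hmo : ∀ a, HasADMMomentum e (𝒟 a) fun i => 1 / (((n : ℝ) - 1) * sphereArea n) * P a i :=
    fun a i => (tendsto_momentumTensor_flux hn hR (H a) (hq a) (hdg a) (hdk a)
      (hP a i)).const_mul _
  exact ⟨_, _, _, _, fun l => hen (some l), hen none, fun l => hmo (some l), hmo none,
    hEt.const_mul _, tendsto_pi_nhds.2 fun i => (hPt i).const_mul _⟩
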